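/- Let $(A,\mathfrak m)$ be a complete equicharacteristic Noetherian local domain of dimension $d+1\ge 2$ whose residue field $k=A/\mathfrak m$ has characteristic zero, and assume that $A$ is not a regular local ring. Fix a coefficient field of $A$, i.e. a ring homomorphism $k\to A$ that is a section of the residue map $A\to k$; we regard $k$ as a subfield of $A$ through it. Let $J\subseteq A$ be an ideal defining the singular locus of $A$, i.e. for a prime $\mathfrak p$ of $A$ one has $J\subseteq\mathfrak p$ if and only if $A_{\mathfrak p}$ is not a regular local ring. Let $0\ne f\in J$ (so $f\in\mathfrak m$) and put $R=A_f$. Let $\ell=k((f))\subseteq R$ be the image of the homomorphism $k((X))\to A_f$ obtained by inverting $X$ in $k[[X]]\to A$, $\sum_i a_iX^i\mapsto\sum_i a_if^i$. Let $D(R)$ be the subring of $\operatorname{Hom}_\ell(R,R)$ generated by the $\ell$-linear derivations of $R$ and the multiplication operators by elements of $R$. For $h\in R$ the localization $R_h$ is a left $D(R)$-module in the natural way: elements of $R$ act by multiplication and derivations act by the quotient rule. Suppose that for every $h\in R$ with $h\neq 0$ the localization $R_h$ is a finitely generated $D(R)$-module. Then for every ideal $I$ of $R$ and every $i\ge 0$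 the set $\operatorname{Ass}_R H^i_I(R)$ of associated primes of the local cohomology module $H^i_I(R)$ is finite. -/

import Mathlib

open IsLocalRing

universe u

noncomputable section

namespace DiffOp

/-! ### Rings of differential operators generated by derivations -/

/-- `diffOps K R` is the ring `D(R)` of `K`-linear differential operators on `R`: the subring of
`Hom_K(R, R)` generated by the `K`-linear derivations of `R` and by the multiplication operators
`x ↦ r * x`, `r ∈ R`. -/
def diffOps (K R : Type*) [CommRing K] [CommRing R] [Algebra K R] : Subring (Module.End K R) :=
  Subring.closure
    (Set.range (fun δ : Derivation K R R => (δ : R →ₗ[K] R)) ∪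
      Set.range (fun r : R => LinearMap.mulLeft K r))

section Extension

variable {K R : Type*} [CommRing K] [CommRing R] [Algebra K R]

theorem derivation_mem_diffOps (δ : Derivation K R R) : (δ : R →ₗ[K] R) ∈ diffOps K R :=
  Subring.subset_closure (Or.inl ⟨δ, rfl⟩)

theorem mulLeft_mem_diffOps (r : R) : LinearMap.mulLeft K r ∈ diffOps K R :=
  Subring.subset_closure (Or.inr ⟨r, rfl⟩)

/-- The `n`-fold commutator of `P` with multiplication by `h` vanishes. -/
def AdNil (h : R) : ℕ → Module.End K R → Prop
  | 0, P => P = 0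
  | n + 1, P => AdNil h n (LinearMap.mulLeft K h * P - P * LinearMap.mulLeft K h)

theorem AdNil.zero (h : R) (n : ℕ) : AdNil h n (0 : Module.End K R) := by
  induction n with
  | zero => rfl
  | succ n ih => simpa [AdNil] using ih

theorem AdNil.add {h : R} {n : ℕ} {P Q : Module.End K R} (hP : AdNil h n P) (hQ : AdNil h n Q) :
    AdNil h n (P + Q) := by
  induction n generalizing P Q with
  | zero => simp_all [AdNil]
  | succ n ih =>
    have := ih hP hQ
    rw [AdNil]
    convert this using 1
    noncomm_ring

theorem AdNil.neg {h : R} {n : ℕ} {P : Module.End K R} (hP : AdNil h n P) :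
    AdNil h n (-P) := by
  induction n generalizing P with
  | zero => simp_all [AdNil]
  | succ n ih =>
    have := ih hP
    rw [AdNil]
    convert this using 1
    ext x
    simp
    ring

theorem AdNil.succ {h : R} {n : ℕ} {P : Module.End K R} (hP : AdNil h n P) :
    AdNil h (n + 1) P := by
  induction n generalizing P with
  | zero => simp_all [AdNil]
  | succ n ih => exact ih hP

theorem AdNil.mono {h : R} {n m : ℕ} (hnm : n ≤ m) {P : Module.End K R} (hP : AdNil h n P) :
    AdNil h m P := by
  induction hnm with
  | refl => exact hP
  | step _ ih => exact ih.succ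

theorem AdNil.mul {h : R} (s : ℕ) {n m : ℕ} (hs : n + m ≤ s) {P Q : Module.End K R}
    (hP : AdNil h n P) (hQ : AdNil h m Q) : AdNil h s (P * Q) := by
  induction s generalizing n m P Q with
  | zero =>
    obtain rfl : n = 0 := by omega
    obtain rfl : P = 0 := hP
    simp [AdNil]
  | succ s ih =>
    cases n with
    | zero =>
      obtain rfl : P = 0 := hP
      rw [zero_mul]; exact AdNil.zero h _
    | succ n =>
      cases m with
      | zero =>
        obtain rfl : Q = 0 := hQ
        rw [mul_zero]; exact AdNil.zero h _
      | succ m =>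
        have h1 := ih (n := n) (m := m + 1) (by omega) (P := _) (Q := Q) hP hQ
        have h2 := ih (n := n + 1) (m := m) (by omega) (P := P) (Q := _) hP hQ
        have := h1.add h2
        rw [AdNil]
        convert this using 1
        rw [sub_mul, mul_sub, mul_assoc, mul_assoc, mul_assoc]
        abel

theorem exists_adNil (h : R) {P : Module.End K R} (hP : P ∈ diffOps K R) : ∃ n, AdNil h n P := by
  induction hP using Subring.closure_induction with
  | mem x hx =>
    refine ⟨2, ?_⟩
    rcases hx with ⟨δ, rfl⟩ | ⟨r, rfl⟩
    · ext x
      simp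
      ring
    · ext x
      simp
      ring
  | zero => exact ⟨0, rfl⟩
  | one => exact ⟨1, by simp [AdNil]⟩
  | add x y _ _ hx hy =>
    obtain ⟨n, hn⟩ := hx
    obtain ⟨m, hm⟩ := hy
    exact ⟨max n m, (hn.mono (le_max_left _ _)).add (hm.mono (le_max_right _ _))⟩
  | neg x _ hx =>
    obtain ⟨n, hn⟩ := hx
    exact ⟨n, hn.neg⟩
  | mul x y _ _ hx hy =>
    obtain ⟨n, hn⟩ := hx
    obtain ⟨m, hm⟩ := hy
    exact ⟨n + m, hn.mul _ le_rfl hm⟩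

/-- Every derivation of `R` extends to a derivation of `R_h` (the quotient rule). -/
theorem exists_derivation_extension (h : R) (δ : Derivation K R R) :
    ∃ δ' : Derivation K (Localization.Away h) (Localization.Away h),
      ∀ r : R, δ' (algebraMap R _ r) = algebraMap R _ (δ r) := by
  have := Algebra.FormallyEtale.of_isLocalization (R := R) (Rₘ := Localization.Away h)
    (Submonoid.powers h)
  have hb := KaehlerDifferential.isBaseChange_of_formallyEtale K R (Localization.Away h)
  let g : Ω[R⁄K] →ₗ[R] Localization.Away h :=
    (Algebra.linearMap R (Localization.Away h)).comp δ.liftKaehlerDifferential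
  refine ⟨(hb.lift g).compDer (KaehlerDifferential.D K (Localization.Away h)), fun r => ?_⟩
  have := hb.lift_eq g (KaehlerDifferential.D K R r)
  simpa [g] using this

theorem eq_zero_of_adNil (h : R) (n : ℕ) (P : Module.End K (Localization.Away h))
    (hn : AdNil (algebraMap R _ h) n P) (hP : ∀ r : R, P (algebraMap R _ r) = 0) : P = 0 := by
  induction n generalizing P with
  | zero => exact hn
  | succ n ih =>
    have key := ih _ hn (fun r => by
      simp [hP, ← map_mul])
    have hcomm : ∀ x, P (algebraMap R _ h * x) = algebraMap R _ h * P x := fun x => by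
      have := LinearMap.congr_fun key x
      simp only [LinearMap.sub_apply, Module.End.mul_apply, LinearMap.mulLeft_apply,
        LinearMap.zero_apply] at this
      exact (sub_eq_zero.mp this).symm
    have hpow : ∀ (m : ℕ) x, P (algebraMap R _ h ^ m * x) = algebraMap R _ h ^ m * P x := by
      intro m
      induction m with
      | zero => simp
      | succ m ihm => intro x; rw [pow_succ, mul_assoc, ihm, hcomm, mul_assoc]
    ext x
    obtain ⟨m, a, ha⟩ := IsLocalization.Away.surj h x
    have hu : IsUnit (algebraMap R (Localization.Away h) h ^ m) :=
      (IsLocalization.Away.algebraMap_isUnit h).pow m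
    have := hpow m x
    rw [mul_comm, ha, hP] at this
    exact (hu.mul_right_eq_zero.mp this.symm)

/-- Every differential operator on `R` extends in exactly one way to a differential operator on
the localization `R_h`. -/
theorem existsUnique_extension (h : R) (P : diffOps K R) :
    ∃! P' : diffOps K (Localization.Away h),
      ∀ r : R, P'.1 (algebraMap R _ r) = algebraMap R _ (P.1 r) := by
  refine existsUnique_of_exists_of_unique ?_ ?_
  · obtain ⟨P, hP⟩ := P
    change ∃ P' : diffOps K (Localization.Away h),
      ∀ r : R, P'.1 (algebraMap R _ r) = algebraMap R _ (P r)
    induction hP using Subring.closure_induction with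
    | mem x hx =>
      rcases hx with ⟨δ, rfl⟩ | ⟨r, rfl⟩
      · obtain ⟨δ', hδ⟩ := exists_derivation_extension h δ
        exact ⟨⟨_, derivation_mem_diffOps δ'⟩, hδ⟩
      · exact ⟨⟨_, mulLeft_mem_diffOps (algebraMap R _ r)⟩, fun s => by simp⟩
    | zero => exact ⟨0, fun r => by simp⟩
    | one => exact ⟨1, fun r => by simp⟩
    | add x y _ _ hx hy =>
      obtain ⟨x', hx⟩ := hx
      obtain ⟨y', hy⟩ := hy
      exact ⟨x' + y', fun r => by simp [hx, hy]⟩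
    | neg x _ hx =>
      obtain ⟨x', hx⟩ := hx
      exact ⟨-x', fun r => by simp [hx]⟩
    | mul x y _ _ hx hy =>
      obtain ⟨x', hx⟩ := hx
      obtain ⟨y', hy⟩ := hy
      exact ⟨x' * y', fun r => by simp [hx, hy]⟩
  · intro P₁ P₂ h₁ h₂
    obtain ⟨n, hn⟩ := exists_adNil (algebraMap R (Localization.Away h) h) (P₁ - P₂).2
    have := eq_zero_of_adNil h n _ hn (fun r => by simp [h₁, h₂])
    exact sub_eq_zero.mp (Subtype.ext this)

/-- The unique extension of a differential operator on `R` to a differential operator on `R_h`. -/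
def extendFun (h : R) (P : diffOps K R) : diffOps K (Localization.Away h) :=
  (existsUnique_extension h P).choose

theorem extendFun_algebraMap (h : R) (P : diffOps K R) (r : R) :
    (extendFun h P).1 (algebraMap R _ r) = algebraMap R _ (P.1 r) :=
  (existsUnique_extension h P).choose_spec.1 r

theorem extendFun_eq (h : R) (P : diffOps K R) (P' : diffOps K (Localization.Away h))
    (hP : ∀ r : R, P'.1 (algebraMap R _ r) = algebraMap R _ (P.1 r)) : extendFun h P = P' :=
  ((existsUnique_extension h P).choose_spec.2 P' hP).symm

/-- Extension of differential operators from `R` to `R_h` as a ring homomorphism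
`D(R) → D(R_h)`. -/
def extend (K : Type*) {R : Type*} [CommRing K] [CommRing R] [Algebra K R] (h : R) :
    diffOps K R →+* diffOps K (Localization.Away h) where
  toFun P := extendFun h P
  map_one' := extendFun_eq h _ _ fun r => by simp
  map_zero' := extendFun_eq h _ _ fun r => by simp
  map_add' P Q := extendFun_eq h _ _ fun r => by
    have hP := extendFun_algebraMap h P r
    have hQ := extendFun_algebraMap h Q r
    simp_all
  map_mul' P Q := extendFun_eq h _ _ fun r => by
    have hP := extendFun_algebraMap h P (Q.1 r)
    have hQ := extendFun_algebraMap h Q r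
    simp_all

/-- The natural `D(R)`-module structure on `R_h`: an operator acts through its unique extension to
a differential operator on `R_h`. -/
instance moduleAway (K : Type*) {R : Type*} [CommRing K] [CommRing R] [Algebra K R] (h : R) :
    Module (diffOps K R) (Localization.Away h) :=
  Module.compHom (Localization.Away h) (extend K h)

theorem smul_algebraMap (h : R) (P : diffOps K R) (r : R) :
    P • algebraMap R (Localization.Away h) r = algebraMap R (Localization.Away h) (P.1 r) :=
  extendFun_algebraMap h P r

/-- Multiplication operators act on `R_h` by multiplication. -/
theorem mulLeft_smul (h r : R) (x : Localization.Away h) :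
    (⟨LinearMap.mulLeft K r, mulLeft_mem_diffOps r⟩ : diffOps K R) • x = r • x := by
  have : extend K h ⟨LinearMap.mulLeft K r, mulLeft_mem_diffOps r⟩ =
      ⟨_, mulLeft_mem_diffOps (algebraMap R (Localization.Away h) r)⟩ :=
    extendFun_eq h _ _ (fun s => by simp)
  change (extend K h _).1 x = _
  rw [this]
  simp [Algebra.smul_def]

/-- Derivations act on `R_h` by the Leibniz rule, hence by the quotient rule. -/
theorem derivation_smul_mul (h : R) (δ : Derivation K R R) (x y : Localization.Away h) :
    (⟨(δ : R →ₗ[K] R), derivation_mem_diffOps δ⟩ : diffOps K R) • (x * y) =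
      x * ((⟨(δ : R →ₗ[K] R), derivation_mem_diffOps δ⟩ : diffOps K R) • y) +
        y * ((⟨(δ : R →ₗ[K] R), derivation_mem_diffOps δ⟩ : diffOps K R) • x) := by
  obtain ⟨δ', hδ⟩ := exists_derivation_extension h δ
  have : extend K h ⟨(δ : R →ₗ[K] R), derivation_mem_diffOps δ⟩ =
      ⟨_, derivation_mem_diffOps δ'⟩ :=
    extendFun_eq h _ _ (fun s => hδ s)
  change (extend K h _).1 (x * y) = x * (extend K h _).1 y + y * (extend K h _).1 x
  rw [this]
  exact δ'.leibniz x y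

end Extension

/-! ### The subfield `k((f))` of `A_f` -/

section Laurent

variable {k A : Type*} [Field k] [CommRing A] (I : Ideal A) (σ : k →+* A) (f : A)

theorem mk_eval₂_congr (hf : f ∈ I) (n : ℕ) (p q : Polynomial k)
    (hpq : ∀ d < n, p.coeff d = q.coeff d) :
    Ideal.Quotient.mk (I ^ n) (p.eval₂ σ f) = Ideal.Quotient.mk (I ^ n) (q.eval₂ σ f) := by
  rw [Ideal.Quotient.eq, ← Polynomial.eval₂_sub]
  obtain ⟨c, hc⟩ : Polynomial.X ^ n ∣ p - q :=
    Polynomial.X_pow_dvd_iff.mpr fun d hd => by simp [hpq d hd]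
  rw [hc, Polynomial.eval₂_mul, Polynomial.eval₂_X_pow]
  exact Ideal.mul_mem_right _ _ (Ideal.pow_mem_pow hf n)

/-- Evaluation of power series at `f ∈ I`, modulo `I ^ n`. -/
def evalMod (hf : f ∈ I) (n : ℕ) : PowerSeries k →+* A ⧸ I ^ n where
  toFun g := Ideal.Quotient.mk (I ^ n) ((g.trunc n).eval₂ σ f)
  map_one' := by
    rw [mk_eval₂_congr I σ f hf n _ 1 fun d hd => by
      rw [PowerSeries.coeff_trunc, if_pos hd, PowerSeries.coeff_one, Polynomial.coeff_one]]
    simp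
  map_zero' := by simp
  map_add' a b := by simp [Polynomial.eval₂_add]
  map_mul' a b := by
    rw [← map_mul, ← Polynomial.eval₂_mul]
    refine mk_eval₂_congr I σ f hf n _ _ fun d hd => ?_
    rw [PowerSeries.coeff_trunc, if_pos hd, ← Polynomial.coeff_coe, Polynomial.coe_mul]
    have := congrArg (fun p => p.coeff d) (PowerSeries.trunc_trunc_mul_trunc (n := n) a b)
    simp only [PowerSeries.coeff_trunc, if_pos hd] at this
    exact this.symm

theorem factorPow_comp_evalMod (hf : f ∈ I) {m n : ℕ} (hle : m ≤ n) :
    (Ideal.Quotient.factorPow I hle).comp (evalMod I σ f hf n) = evalMod I σ f hf m := by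
  ext g
  change Ideal.Quotient.mk (I ^ m) ((g.trunc n).eval₂ σ f) = _
  refine mk_eval₂_congr I σ f hf m _ _ fun d hd => ?_
  rw [PowerSeries.coeff_trunc, PowerSeries.coeff_trunc, if_pos hd, if_pos (by omega)]

/-- The map `k[[X]] → A`, `∑ aᵢ Xⁱ ↦ ∑ σ(aᵢ) fⁱ`, for `A` complete in the `I`-adic topology and
`f ∈ I`. -/
def powerSeriesMap [IsAdicComplete I A] (hf : f ∈ I) : PowerSeries k →+* A :=
  IsAdicComplete.liftRingHom I (evalMod I σ f hf) (factorPow_comp_evalMod I σ f hf)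

theorem mk_powerSeriesMap [IsAdicComplete I A] (hf : f ∈ I) (n : ℕ) (g : PowerSeries k) :
    Ideal.Quotient.mk (I ^ n) (powerSeriesMap I σ f hf g) =
      Ideal.Quotient.mk (I ^ n) ((g.trunc n).eval₂ σ f) :=
  IsAdicComplete.mk_liftRingHom I _ (factorPow_comp_evalMod I σ f hf) n g

theorem powerSeriesMap_coe [IsAdicComplete I A] (hf : f ∈ I) (p : Polynomial k) :
    powerSeriesMap I σ f hf (p : PowerSeries k) = p.eval₂ σ f := by
  refine IsHausdorff.eq_iff_smodEq (I := I) |>.mpr fun n => ?_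
  rw [smul_eq_mul, Ideal.mul_top, SModEq.def]
  refine (mk_powerSeriesMap I σ f hf n p).trans ?_
  refine mk_eval₂_congr I σ f hf n _ _ fun d hd => ?_
  rw [PowerSeries.coeff_trunc, if_pos hd, Polynomial.coeff_coe]

theorem powerSeriesMap_X [IsAdicComplete I A] (hf : f ∈ I) :
    powerSeriesMap I σ f hf PowerSeries.X = f := by
  simpa using powerSeriesMap_coe I σ f hf Polynomial.X

theorem powerSeriesMap_C [IsAdicComplete I A] (hf : f ∈ I) (c : k) :
    powerSeriesMap I σ f hf (PowerSeries.C c) = σ c := by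
  simpa using powerSeriesMap_coe I σ f hf (Polynomial.C c)

/-- The map `k((X)) → A_f` obtained from `k[[X]] → A` by inverting `X`, which is sent to `f`. -/
def laurentMap [IsAdicComplete I A] (hf : f ∈ I) : LaurentSeries k →+* Localization.Away f :=
  IsLocalization.lift (M := Submonoid.powers (PowerSeries.X : PowerSeries k))
    (g := (algebraMap A (Localization.Away f)).comp (powerSeriesMap I σ f hf)) (by
      rintro ⟨_, n, rfl⟩
      simpa [powerSeriesMap_X] using (IsLocalization.Away.algebraMap_isUnit f).pow n)

/-- The field `ℓ = k((f)) ⊆ A_f`, the image of `k((X)) → A_f`. -/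
def laurentSubfield [IsAdicComplete I A] (hf : f ∈ I) : Subring (Localization.Away f) :=
  (laurentMap I σ f hf).range

end Laurent

/-! ### The singular locus -/

/-- The singular locus of `A`: the primes `𝔭` such that `A_𝔭` is not a regular local ring. -/
def singularLocus (A : Type*) [CommRing A] : Set (PrimeSpectrum A) :=
  {p | ¬ IsRegularLocalRing (Localization.AtPrime p.asIdeal)}

/-- An ideal defining the singular locus of a non-regular local ring is contained in the maximal
ideal. -/
theorem mem_maximalIdeal_of_mem {A : Type*} [CommRing A] [IsLocalRing A]
    (hA : ¬ IsRegularLocalRing A) {J : Ideal A}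
    (hJ : PrimeSpectrum.zeroLocus (J : Set A) = singularLocus A) {f : A} (hf : f ∈ J) :
    f ∈ maximalIdeal A := by
  have hm : (⟨maximalIdeal A, inferInstance⟩ : PrimeSpectrum A) ∈ singularLocus A := by
    intro (hreg : IsRegularLocalRing (Localization.AtPrime (maximalIdeal A)))
    let e : A ≃ₐ[A] Localization.AtPrime (maximalIdeal A) :=
      IsLocalization.atUnits A (maximalIdeal A).primeCompl (fun x ↦ by simpa using! fun a ↦ a)
    exact hA (IsRegularLocalRing.of_ringEquiv e.toRingEquiv.symm)
  rw [← hJ] at hm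
  exact hm hf

end DiffOp

end

/-!
The local cohomology modules of `R = A_f` are controlled through a ring of operators acting on them.

Let `T` be the ring generated by `R` and a free symbol for every derivation of `R` over
`ℓ = k((f))`, subject only to the Leibniz rule (`OperatorRing`). A `T`-module is an `R`-module with
arbitrary operators satisfying the Leibniz rule; no relations between the operators are imposed, so
operators extend freely. In particular every `T`-module embeds in a `T`-module that is injective
over `R` (`exists_injective_embedding`), because an operator on a submodule of an `R`-injective
module extends to the whole module: a Leibniz operator is a linear map to a twisted module, again an
extension of injectives. So `R` has a resolution by `T`-modules that are `R`-injective
(`Stage.exists_resolution`), and local cohomology, defined as a colimit of `Ext` modules, is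
`Γ_I(M) / π(Γ_I(E))` for its stages `π : E → M`
(`Stage.nonempty_torsionQuotient_linearEquiv`, by dimension shifting). These quotients are
`T`-modules.

Call a `T`-module away-Noetherian if all its localizations at one element of `R` are Noetherian over
`T`. This passes to submodules, quotients, extensions and localizations, so an induction over the
number of generators of `I`, with the exact sequence
`H^i_I(M)_x → H^{i+1}_{I+(x)}(M) → H^{i+1}_I(M)`, shows that `H^i_I(M)` is away-Noetherian if `M` is
(`Stage.awayNoetherian_torsionQuotient`). A `T`-module that is Noetherian over `T` has finitely many
associated primes over `R` (`finite_associatedPrimes`): for a maximal associated prime `P` the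
sections supported on `P` are a `T`-submodule with `P` as only associated prime.

It remains to see that `R` is away-Noetherian, that is, that the finitely generated `D(R)`-modules
`R_h` are Noetherian; it is enough that `D(R)` is left Noetherian. The derivations of `R` over `ℓ`
form a finitely generated `R`-module (`finite_derivation_laurentSubfield`): for a maximal ideal `n`
of `R` with contraction `q`, all primes of `A` properly containing `q` contain `f`, so by Krull's
principal ideal theorem `A / (q + fA)` has finite length, and by completeness `A / q` is finite over
`k[[f]]`; so `R / n` is finite over `ℓ`, and a derivation is determined by its values on finitely
many elements, since its values would otherwise lie in all powers of `n`. Hence `D(R)` is almost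
commutative over `R` with finitely many generators, and its left ideals are controlled by their
leading symbols in a polynomial ring (`AlmostCommutes.isNoetherianRing`).
-/

noncomputable section

namespace DiffOp

/-! ### The ring generated by a family of derivations -/

section OperatorRing

variable {R ι : Type*} [CommRing R] (δ : ι → Derivation ℤ R R)

/-- The defining relations of `OperatorRing δ`: the symbols `inl r` form a copy of `R`, and the
symbols `inr i` satisfy the Leibniz commutation rule `tᵢ r = δᵢ(r) + r tᵢ`. -/
inductive OperatorRing.Rel : FreeAlgebra ℤ (R ⊕ ι) → FreeAlgebra ℤ (R ⊕ ι) → Prop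
  | one : Rel (FreeAlgebra.ι ℤ (Sum.inl 1)) 1
  | add (r s : R) : Rel (FreeAlgebra.ι ℤ (Sum.inl (r + s)))
      (FreeAlgebra.ι ℤ (Sum.inl r) + FreeAlgebra.ι ℤ (Sum.inl s))
  | mul (r s : R) : Rel (FreeAlgebra.ι ℤ (Sum.inl (r * s)))
      (FreeAlgebra.ι ℤ (Sum.inl r) * FreeAlgebra.ι ℤ (Sum.inl s))
  | leibniz (i : ι) (r : R) : Rel (FreeAlgebra.ι ℤ (Sum.inr i) * FreeAlgebra.ι ℤ (Sum.inl r))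
      (FreeAlgebra.ι ℤ (Sum.inl (δ i r)) +
        FreeAlgebra.ι ℤ (Sum.inl r) * FreeAlgebra.ι ℤ (Sum.inr i))

/-- The ring generated by `R` and one symbol `tᵢ` for each derivation `δᵢ` of the family, subject
only to `tᵢ r = δᵢ(r) + r tᵢ`. Its modules are the `R`-modules with a family of additive operators
satisfying the Leibniz rule over the `δᵢ`; no relation between the `tᵢ` is imposed. -/
def OperatorRing : Type _ := RingQuot (OperatorRing.Rel δ)

namespace OperatorRing

instance : Ring (OperatorRing δ) := inferInstanceAs (Ring (RingQuot (Rel δ)))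

/-- The presentation of the operator ring as a quotient of a free algebra. -/
def mkHom : FreeAlgebra ℤ (R ⊕ ι) →+* OperatorRing δ := RingQuot.mkRingHom (Rel δ)

variable {δ} in
theorem mkHom_rel {x y : FreeAlgebra ℤ (R ⊕ ι)} (h : Rel δ x y) : mkHom δ x = mkHom δ y :=
  RingQuot.mkRingHom_rel h

theorem mkHom_surjective : Function.Surjective (mkHom δ) := RingQuot.mkRingHom_surjective _

/-- The inclusion of `R` in the operator ring. -/
def coeff : R →+* OperatorRing δ where
  toFun r := mkHom δ (FreeAlgebra.ι ℤ (Sum.inl r))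
  map_one' := (mkHom_rel Rel.one).trans (map_one _)
  map_mul' r s := (mkHom_rel (Rel.mul r s)).trans (map_mul _ _ _)
  map_zero' := by
    have h := (mkHom_rel (Rel.add (δ := δ) 0 0)).trans (map_add _ _ _)
    rw [add_zero] at h
    exact left_eq_add.mp h
  map_add' r s := (mkHom_rel (Rel.add r s)).trans (map_add _ _ _)

/-- The symbol attached to the `i`-th derivation. -/
def symbol (i : ι) : OperatorRing δ :=
  mkHom δ (FreeAlgebra.ι ℤ (Sum.inr i))

theorem symbol_mul_coeff (i : ι) (r : R) :
    symbol δ i * coeff δ r = coeff δ (δ i r) + coeff δ r * symbol δ i := by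
  have h := mkHom_rel (Rel.leibniz (δ := δ) i r)
  rw [map_mul, map_add, map_mul] at h
  exact h

instance : Module R (OperatorRing δ) := Module.compHom _ (coeff δ)

variable {δ} in
theorem smul_def (r : R) (t : OperatorRing δ) : r • t = coeff δ r * t := rfl

instance : IsScalarTower R (OperatorRing δ) (OperatorRing δ) :=
  ⟨fun r s t => by rw [smul_def, smul_def, smul_eq_mul, smul_eq_mul, mul_assoc]⟩

variable {δ} in
theorem induction {p : OperatorRing δ → Prop} (hc : ∀ r, p (coeff δ r)) (hs : ∀ i, p (symbol δ i))
    (hadd : ∀ a b, p a → p b → p (a + b)) (hmul : ∀ a b, p a → p b → p (a * b))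
    (t : OperatorRing δ) : p t := by
  obtain ⟨x, rfl⟩ := mkHom_surjective δ t
  induction x using FreeAlgebra.induction with
  | grade0 n =>
    have : mkHom δ (algebraMap ℤ _ n) = coeff δ n := by
      rw [eq_intCast, map_intCast, map_intCast]
    exact this ▸ hc _
  | grade1 x =>
    rcases x with r | i
    · exact hc r
    · exact hs i
  | mul a b ha hb => rw [map_mul]; exact hmul _ _ ha hb
  | add a b ha hb => rw [map_add]; exact hadd _ _ ha hb

section Modules

variable {M N : Type*} [AddCommGroup M] [Module R M] [AddCommGroup N] [Module R N]

/-- The action of the generators of the free algebra through Leibniz operators. -/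
def freeToEnd (D : ι → M →+ M) : FreeAlgebra ℤ (R ⊕ ι) →+* AddMonoid.End M :=
  (FreeAlgebra.lift ℤ (Sum.elim (fun r => Module.toAddMonoidEnd R M r) D) :
    FreeAlgebra ℤ (R ⊕ ι) →ₐ[ℤ] AddMonoid.End M).toRingHom

theorem freeToEnd_inl (D : ι → M →+ M) (r : R) (m : M) :
    freeToEnd D (FreeAlgebra.ι ℤ (Sum.inl r)) m = r • m :=
  congrArg (fun g : AddMonoid.End M => g m) (FreeAlgebra.lift_ι_apply _ _)

theorem freeToEnd_inr (D : ι → M →+ M) (i : ι) (m : M) :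
    freeToEnd (R := R) D (FreeAlgebra.ι ℤ (Sum.inr i)) m = D i m :=
  congrArg (fun g : AddMonoid.End M => g m) (FreeAlgebra.lift_ι_apply _ _)

variable {δ} in
/-- The ring homomorphism out of the operator ring given by Leibniz operators on an `R`-module. -/
def toEnd (D : ι → M →+ M) (hD : ∀ i (r : R) m, D i (r • m) = δ i r • m + r • D i m) :
    OperatorRing δ →+* AddMonoid.End M :=
  RingQuot.lift (r := Rel δ) ⟨freeToEnd D, by
    intro a b hab
    ext m
    cases hab with
    | one => rw [freeToEnd_inl, map_one, one_smul]; rfl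
    | add r s =>
      rw [map_add, freeToEnd_inl, add_smul, ← freeToEnd_inl D r, ← freeToEnd_inl D s]; rfl
    | mul r s =>
      rw [map_mul, freeToEnd_inl, mul_smul, ← freeToEnd_inl D s, ← freeToEnd_inl D r]; rfl
    | leibniz i r =>
      have h := hD i r m
      rw [← freeToEnd_inl D (δ i r), ← freeToEnd_inr (R := R) D i, ← freeToEnd_inr (R := R) D i,
        ← freeToEnd_inl D r, ← freeToEnd_inl D r] at h
      rw [map_mul, map_add, map_mul]
      exact h⟩

theorem toEnd_mkHom (D : ι → M →+ M) (hD : ∀ i (r : R) m, D i (r • m) = δ i r • m + r • D i m)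
    (x : FreeAlgebra ℤ (R ⊕ ι)) : toEnd D hD (mkHom δ x) = freeToEnd D x :=
  RingQuot.lift_mkRingHom_apply _ _ _

theorem toEnd_coeff (D : ι → M →+ M) (hD : ∀ i (r : R) m, D i (r • m) = δ i r • m + r • D i m)
    (r : R) (m : M) : toEnd D hD (coeff δ r) m = r • m :=
  (congrArg (fun g : AddMonoid.End M => g m) (toEnd_mkHom δ D hD _)).trans (freeToEnd_inl D r m)

theorem toEnd_symbol (D : ι → M →+ M)
    (hD : ∀ i (r : R) m, D i (r • m) = δ i r • m + r • D i m)
    (i : ι) (m : M) : toEnd D hD (symbol δ i) m = D i m :=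
  (congrArg (fun g : AddMonoid.End M => g m) (toEnd_mkHom δ D hD _)).trans (freeToEnd_inr D i m)

variable {δ} in
/-- The module over the operator ring defined by Leibniz operators on an `R`-module. -/
abbrev moduleOfOperators (D : ι → M →+ M)
    (hD : ∀ i (r : R) m, D i (r • m) = δ i r • m + r • D i m) : Module (OperatorRing δ) M :=
  Module.compHom M (toEnd D hD)

theorem isScalarTower_moduleOfOperators (D : ι → M →+ M)
    (hD : ∀ i (r : R) m, D i (r • m) = δ i r • m + r • D i m) :
    letI := moduleOfOperators D hD
    IsScalarTower R (OperatorRing δ) M :=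
  letI := moduleOfOperators D hD
  ⟨fun r s m => by
    change toEnd D hD (coeff δ r * s) m = r • toEnd D hD s m
    rw [map_mul]
    exact toEnd_coeff δ D hD r _⟩

variable [Module (OperatorRing δ) M] [IsScalarTower R (OperatorRing δ) M]
  [Module (OperatorRing δ) N] [IsScalarTower R (OperatorRing δ) N]

theorem coeff_smul (r : R) (m : M) : coeff δ r • m = r • m := by
  rw [← mul_one (coeff δ r), ← smul_def, smul_assoc, one_smul]

theorem symbol_smul_smul (i : ι) (r : R) (m : M) :
    symbol δ i • r • m = δ i r • m + r • symbol δ i • m := by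
  rw [← coeff_smul δ r m, ← mul_smul, symbol_mul_coeff, add_smul, mul_smul, coeff_smul,
    coeff_smul]

variable {δ} in
/-- An `R`-linear map commuting with the symbols is linear over the operator ring. -/
def linearMapOfCommute (g : M →ₗ[R] N) (hg : ∀ i m, g (symbol δ i • m) = symbol δ i • g m) :
    M →ₗ[OperatorRing δ] N where
  toFun := g
  map_add' := map_add g
  map_smul' t := by
    induction t using OperatorRing.induction with
    | hc r => intro m; simp [coeff_smul]
    | hs i => exact hg i
    | hadd a b ha hb => intro m; simp_all [add_smul]
    | hmul a b ha hb => intro m; simp_all [mul_smul]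

variable {δ} in
/-- An `R`-submodule stable under the symbols is a submodule over the operator ring. -/
def submoduleOfStable (P : Submodule R M) (hP : ∀ i, ∀ m ∈ P, symbol δ i • m ∈ P) :
    Submodule (OperatorRing δ) M where
  carrier := P
  add_mem' := P.add_mem
  zero_mem' := P.zero_mem
  smul_mem' t := by
    induction t using OperatorRing.induction with
    | hc r => intro m hm; rw [coeff_smul]; exact P.smul_mem r hm
    | hs i => exact fun {m} hm => hP i m hm
    | hadd a b ha hb => intro m hm; rw [add_smul]; exact P.add_mem (ha hm) (hb hm)
    | hmul a b ha hb => intro m hm; rw [mul_smul]; exact ha (hb hm)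

end Modules

end OperatorRing

end OperatorRing

/-! ### Leibniz operators as linear maps to a twisted module -/

section Twist

variable {R : Type*} [CommRing R]

/-- The `R`-module `Q × Q` with the scalar multiplication `r (a, b) = (r a, r b + d(r) a)`. An
additive map `D : M → Q` satisfies the Leibniz rule over `d` along a linear map `φ : M → Q` exactly
when `m ↦ (φ m, D m)` is linear into this module. -/
def Twist (_d : Derivation ℤ R R) (Q : Type*) : Type _ := Q × Q

namespace Twist

variable (d : Derivation ℤ R R) (Q : Type*) [AddCommGroup Q] [Module R Q]

instance : AddCommGroup (Twist d Q) := inferInstanceAs (AddCommGroup (Q × Q))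

instance : Module R (Twist d Q) where
  smul r x := (r • x.1, r • x.2 + d r • x.1)
  one_smul x := by
    refine Prod.ext (one_smul _ _) ?_
    change (1 : R) • x.2 + d 1 • x.1 = x.2
    simp
  mul_smul r s x := by
    refine Prod.ext (mul_smul _ _ _) ?_
    change (r * s) • x.2 + d (r * s) • x.1 = r • (s • x.2 + d s • x.1) + d r • s • x.1
    rw [d.leibniz, smul_eq_mul, smul_eq_mul, mul_comm s]
    module
  smul_zero r := by
    refine Prod.ext (smul_zero _) ?_
    change r • (0 : Q) + d r • (0 : Q) = 0
    simp
  smul_add r x y := by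
    refine Prod.ext (smul_add _ _ _) ?_
    change r • (x.2 + y.2) + d r • (x.1 + y.1) = (r • x.2 + d r • x.1) + (r • y.2 + d r • y.1)
    module
  add_smul r s x := by
    refine Prod.ext (add_smul _ _ _) ?_
    change (r + s) • x.2 + d (r + s) • x.1 = (r • x.2 + d r • x.1) + (s • x.2 + d s • x.1)
    rw [map_add]
    module
  zero_smul x := by
    refine Prod.ext (zero_smul _ _) ?_
    change (0 : R) • x.2 + d 0 • x.1 = 0
    simp

variable {Q}

theorem smul_snd (r : R) (x : Twist d Q) : (r • x).2 = r • x.2 + d r • x.1 := rfl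

variable (Q) in
/-- The first projection of the twisted module. -/
def fst : Twist d Q →ₗ[R] Q where
  toFun x := x.1
  map_add' _ _ := rfl
  map_smul' _ _ := rfl

variable (Q) in
/-- The second inclusion into the twisted module. -/
def inr : Q →ₗ[R] Twist d Q where
  toFun x := (0, x)
  map_add' x y := Prod.ext (add_zero 0).symm rfl
  map_smul' r x := by
    refine Prod.ext (smul_zero r).symm ?_
    change r • x = r • x + d r • (0 : Q)
    simp

variable {M : Type*} [AddCommGroup M] [Module R M]

/-- The linear map to the twisted module defined by an operator satisfying the Leibniz rule. -/
def lift (φ : M →ₗ[R] Q) (D : M →+ Q) (hD : ∀ (r : R) m, D (r • m) = d r • φ m + r • D m) :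
    M →ₗ[R] Twist d Q where
  toFun m := (φ m, D m)
  map_add' x y := Prod.ext (map_add φ x y) (map_add D x y)
  map_smul' r m := Prod.ext (map_smul φ r m) ((hD r m).trans (add_comm _ _))

/-- The operator defined by the second component of a linear map to the twisted module. -/
def operator (g : M →ₗ[R] Twist d Q) : M →+ Q where
  toFun m := (g m).2
  map_zero' := by rw [map_zero]; rfl
  map_add' x y := by rw [map_add]; rfl

theorem operator_smul (g : M →ₗ[R] Twist d Q) (r : R) (m : M) :
    operator d g (r • m) = d r • (g m).1 + r • operator d g m := by
  change (g (r • m)).2 = d r • (g m).1 + r • (g m).2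
  rw [map_smul, smul_snd, add_comm]

/-- Every operator on a submodule of an injective module satisfying the Leibniz rule extends to the
injective module: the extension `0 → E → Twist d E → E → 0` splits, which yields some operator on
`E`, and the difference to the given one is linear. -/
theorem exists_extension {E : Type u} {R : Type u} [CommRing R] (d : Derivation ℤ R R)
    {M : Type u} [AddCommGroup M] [Module R M] [AddCommGroup E] [Module R E] [Module.Injective R E]
    (φ : M →ₗ[R] E) (hφ : Function.Injective φ) (D : M →+ M)
    (hD : ∀ (r : R) m, D (r • m) = d r • m + r • D m) :
    ∃ D' : E →+ E, (∀ (r : R) e, D' (r • e) = d r • e + r • D' e) ∧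
      ∀ m, D' (φ m) = φ (D m) := by
  obtain ⟨p, hp⟩ := Module.Injective.out (inr d E)
    (fun x y h => congrArg Prod.snd h) (LinearMap.id (R := R) (M := E))
  let inl (e : E) : Twist d E := (e, 0)
  have hinl_add (x y : E) : inl (x + y) = inl x + inl y := Prod.ext rfl (add_zero 0).symm
  have hinl_smul (r : R) (x : E) : r • inl x = inl (r • x) + inr d E (d r • x) := by
    refine Prod.ext ?_ ?_
    · change r • x = r • x + 0
      simp
    · change r • (0 : E) + d r • x = 0 + d r • x
      simp
  -- the splitting `p`, restricted to the first summand, is the required operator up to sign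
  let D₀ : E →+ E := AddMonoidHom.mk' (fun e => - p (inl e)) fun x y => by
    rw [hinl_add, map_add, neg_add]
  have hD₀ : ∀ (r : R) e, D₀ (r • e) = d r • e + r • D₀ e := fun r e => by
    change - p (inl (r • e)) = d r • e + r • - p (inl e)
    have h2 : r • p (inl e) = p (inl (r • e)) + d r • e := by
      rw [← map_smul, hinl_smul, map_add, hp, LinearMap.id_apply]
    rw [smul_neg, h2]
    abel
  let lin : M →ₗ[R] E :=
    { toFun := fun m => φ (D m) - D₀ (φ m)
      map_add' := fun x y => by simp only [map_add]; abel
      map_smul' := fun r m => by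
        simp only [hD, hD₀, map_add, map_smul, RingHom.id_apply]
        module }
  obtain ⟨l, hl⟩ := Module.Injective.out φ hφ lin
  refine ⟨D₀ + l.toAddMonoidHom, fun r e => ?_, fun m => ?_⟩
  · simp only [AddMonoidHom.add_apply, hD₀, LinearMap.toAddMonoidHom_coe, map_smul]
    module
  · simp only [AddMonoidHom.add_apply, LinearMap.toAddMonoidHom_coe, hl]
    change _ + (φ (D m) - D₀ (φ m)) = _
    abel

end Twist

end Twist

/-! ### Injective modules over the operator ring -/

section Embedding

variable {R ι : Type u} [CommRing R] (δ : ι → Derivation ℤ R R)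

open OperatorRing CategoryTheory in
/-- Every module over the operator ring embeds in one which is injective over `R`. -/
theorem exists_injective_embedding (M : Type u) [AddCommGroup M] [Module R M]
    [Module (OperatorRing δ) M] [IsScalarTower R (OperatorRing δ) M] :
    ∃ (E : Type u) (_ : AddCommGroup E) (_ : Module R E) (_ : Module (OperatorRing δ) E)
      (_ : IsScalarTower R (OperatorRing δ) E) (φ : M →ₗ[OperatorRing δ] E),
      Module.Injective R E ∧ Function.Injective φ := by
  let E : ModuleCat.{u} R := Injective.under (ModuleCat.of R M)
  let φ : M →ₗ[R] E := (Injective.ι (ModuleCat.of R M)).hom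
  have hφ : Function.Injective φ := (ModuleCat.mono_iff_injective _).mp inferInstance
  have hE : Module.Injective R E :=
    Module.injective_module_of_injective_object R E (inj := by
      change Injective E
      infer_instance)
  let D (i : ι) : M →+ M := DistribSMul.toAddMonoidHom M (symbol δ i)
  have hD (i : ι) (r : R) (m : M) : D i (r • m) = δ i r • m + r • D i m :=
    symbol_smul_smul δ i r m
  choose D' hD' hφD using fun i => Twist.exists_extension (δ i) φ hφ (D i) (hD i)
  let _ := moduleOfOperators D' hD'
  have := isScalarTower_moduleOfOperators δ D' hD'
  refine ⟨E, inferInstance, inferInstance, inferInstance, inferInstance,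
    linearMapOfCommute φ fun i m => ?_, hE, hφ⟩
  exact (hφD i m).symm.trans (toEnd_symbol δ D' hD' i (φ m)).symm

end Embedding

/-! ### Localization of modules over the operator ring -/

namespace OperatorRing

section Localization

variable {R ι : Type*} [CommRing R] (δ : ι → Derivation ℤ R R) (S : Submonoid R)
variable (M : Type*) [AddCommGroup M] [Module R M] [Module (OperatorRing δ) M]
  [IsScalarTower R (OperatorRing δ) M]

theorem isUnit_algebraMap_end_iff {Q : Type*} [AddCommGroup Q] [Module R Q] (r : R) :
    IsUnit (algebraMap R (Module.End R Q) r) ↔ Function.Bijective fun q : Q => r • q :=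
  Module.End.isUnit_iff _

theorem isUnit_twist (d : Derivation ℤ R R) (s : S) :
    IsUnit (algebraMap R (Module.End R (Twist d (LocalizedModule S M))) s) := by
  rw [isUnit_algebraMap_end_iff]
  have hb : Function.Bijective fun q : LocalizedModule S M => (s : R) • q :=
    (isUnit_algebraMap_end_iff _).mp
      (IsLocalizedModule.map_units (LocalizedModule.mkLinearMap S M) s)
  constructor
  · rintro x y (h : (s : R) • x = (s : R) • y)
    have h1 : x.1 = y.1 := hb.1 (congrArg Prod.fst h)
    have h2 : (s : R) • x.2 + d s • x.1 = (s : R) • y.2 + d s • y.1 := congrArg Prod.snd h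
    rw [h1] at h2
    exact Prod.ext h1 (hb.1 (add_right_cancel h2))
  · rintro ⟨a, b⟩
    obtain ⟨a', rfl⟩ := hb.2 a
    obtain ⟨b', hb'⟩ := hb.2 (b - d s • a')
    refine ⟨((a', b') : LocalizedModule S M × LocalizedModule S M), Prod.ext rfl ?_⟩
    change (s : R) • b' + d s • a' = b
    rw [show (s : R) • b' = _ from hb', sub_add_cancel]

/-- The linear map from the localization to the twisted module which encodes the extension of the
`i`-th symbol to the localization. -/
def localizedLift (i : ι) : LocalizedModule S M →ₗ[R] Twist (δ i) (LocalizedModule S M) :=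
  LocalizedModule.lift S
    (Twist.lift (δ i) (LocalizedModule.mkLinearMap S M)
      ((LocalizedModule.mkLinearMap S M).toAddMonoidHom.comp
        (DistribSMul.toAddMonoidHom M (symbol δ i)))
      fun r m => by
        change LocalizedModule.mkLinearMap S M (symbol δ i • r • m) = _ + r •
          LocalizedModule.mkLinearMap S M (symbol δ i • m)
        rw [symbol_smul_smul, map_add, map_smul, map_smul])
    (isUnit_twist S M (δ i))

theorem localizedLift_mk (i : ι) (m : M) :
    localizedLift δ S M i (LocalizedModule.mkLinearMap S M m) =
      ((LocalizedModule.mkLinearMap S M m, LocalizedModule.mkLinearMap S M (symbol δ i • m)) :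
        LocalizedModule S M × LocalizedModule S M) :=
  LinearMap.congr_fun (LocalizedModule.lift_comp S _ (isUnit_twist S M (δ i))) m

theorem localizedLift_fst (i : ι) (x : LocalizedModule S M) :
    (localizedLift δ S M i x).1 = x := by
  have : (Twist.fst (δ i) _).comp (localizedLift δ S M i) = LinearMap.id :=
    IsLocalizedModule.linearMap_ext S (LocalizedModule.mkLinearMap S M)
      (LocalizedModule.mkLinearMap S M) (by
        ext m
        exact congrArg Prod.fst (localizedLift_mk δ S M i m))
  exact LinearMap.congr_fun this x

/-- The extension of the `i`-th symbol to the localization, by the quotient rule. -/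
def localizedOperator (i : ι) : LocalizedModule S M →+ LocalizedModule S M :=
  Twist.operator (δ i) (localizedLift δ S M i)

theorem localizedOperator_smul (i : ι) (r : R) (x : LocalizedModule S M) :
    localizedOperator δ S M i (r • x) = δ i r • x + r • localizedOperator δ S M i x := by
  rw [localizedOperator, Twist.operator_smul, localizedLift_fst]

instance : Module (OperatorRing δ) (LocalizedModule S M) :=
  moduleOfOperators (localizedOperator δ S M) (localizedOperator_smul δ S M)

instance : IsScalarTower R (OperatorRing δ) (LocalizedModule S M) :=
  isScalarTower_moduleOfOperators δ (localizedOperator δ S M) (localizedOperator_smul δ S M)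

/-- The localization map, as a linear map over the operator ring. -/
def toLocalized : M →ₗ[OperatorRing δ] LocalizedModule S M :=
  linearMapOfCommute (LocalizedModule.mkLinearMap S M) fun i m => by
    refine Eq.trans ?_ (toEnd_symbol δ _ (localizedOperator_smul δ S M) i _).symm
    exact (congrArg Prod.snd (localizedLift_mk δ S M i m)).symm

variable {δ S M}

theorem toLocalized_apply (m : M) :
    toLocalized δ S M m = LocalizedModule.mkLinearMap S M m := rfl

theorem toLocalized_eq_zero_iff (m : M) :
    toLocalized δ S M m = 0 ↔ ∃ s ∈ S, s • m = 0 := by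
  rw [toLocalized_apply, IsLocalizedModule.eq_zero_iff S (LocalizedModule.mkLinearMap S M)]
  exact ⟨fun ⟨s, hs⟩ => ⟨s, s.2, hs⟩, fun ⟨s, hs, h⟩ => ⟨⟨s, hs⟩, h⟩⟩

theorem exists_smul_eq_toLocalized (x : LocalizedModule S M) :
    ∃ s ∈ S, ∃ m, s • x = toLocalized δ S M m := by
  obtain ⟨⟨m, s⟩, e⟩ := IsLocalizedModule.surj S (LocalizedModule.mkLinearMap S M) x
  exact ⟨s, s.2, m, e⟩

theorem smul_localized_bijective {s : R} (hs : s ∈ S) :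
    Function.Bijective fun x : LocalizedModule S M => s • x :=
  (isUnit_algebraMap_end_iff _).mp
    (IsLocalizedModule.map_units (LocalizedModule.mkLinearMap S M) ⟨s, hs⟩)

theorem smul_localized_eq_zero {s : R} (hs : s ∈ S) {x : LocalizedModule S M} (h : s • x = 0) :
    x = 0 :=
  (smul_localized_bijective hs).1 (h.trans (smul_zero s).symm)

variable {N : Type*} [AddCommGroup N] [Module R N] [Module (OperatorRing δ) N]
  [IsScalarTower R (OperatorRing δ) N]

/-- An `R`-linear map out of a localization is linear over the operator ring as soon as its
restriction is, provided that the denominators are nonzerodivisors on the target. -/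
theorem map_symbol_smul_of_comp (g : LocalizedModule S M →ₗ[R] N)
    (hN : ∀ s ∈ S, ∀ n : N, s • n = 0 → n = 0)
    (hg : ∀ i m, g (toLocalized δ S M (symbol δ i • m)) =
      symbol δ i • g (toLocalized δ S M m)) (i : ι) (x : LocalizedModule S M) :
    g (symbol δ i • x) = symbol δ i • g x := by
  obtain ⟨s, hs, m, hm⟩ := exists_smul_eq_toLocalized (δ := δ) x
  have h1 : g (symbol δ i • s • x) = symbol δ i • g (s • x) := by
    rw [hm, ← map_smul (toLocalized δ S M) (symbol δ i), hg]
  rw [symbol_smul_smul, map_add, map_smul g, map_smul g, map_smul g, symbol_smul_smul] at h1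
  rw [← sub_eq_zero]
  refine hN s hs _ ?_
  rw [smul_sub, sub_eq_zero]
  exact add_left_cancel h1

/-- The map of localizations induced by a linear map. -/
def mapLocalized (S : Submonoid R) (f : M →ₗ[OperatorRing δ] N) :
    LocalizedModule S M →ₗ[OperatorRing δ] LocalizedModule S N :=
  linearMapOfCommute (IsLocalizedModule.map S (LocalizedModule.mkLinearMap S M)
      (LocalizedModule.mkLinearMap S N) (f.restrictScalars R))
    (map_symbol_smul_of_comp (δ := δ) _ (fun _ hs _ h => smul_localized_eq_zero hs h) fun i m => by
      rw [toLocalized_apply, toLocalized_apply, IsLocalizedModule.map_apply,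
        IsLocalizedModule.map_apply, LinearMap.restrictScalars_apply,
        LinearMap.restrictScalars_apply, map_smul, ← toLocalized_apply (δ := δ),
        ← toLocalized_apply (δ := δ),
        map_smul])

@[simp]
theorem mapLocalized_toLocalized (f : M →ₗ[OperatorRing δ] N) (m : M) :
    mapLocalized S f (toLocalized δ S M m) = toLocalized δ S N (f m) :=
  IsLocalizedModule.map_apply S _ _ _ _

theorem mapLocalized_smul (f : M →ₗ[OperatorRing δ] N) (r : R) (x : LocalizedModule S M) :
    mapLocalized S f (r • x) = r • mapLocalized S f x :=
  map_smul ((mapLocalized S f).restrictScalars R) r x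

theorem mapLocalized_surjective {f : M →ₗ[OperatorRing δ] N} (hf : Function.Surjective f) :
    Function.Surjective (mapLocalized S f) :=
  IsLocalizedModule.map_surjective S (LocalizedModule.mkLinearMap S M)
    (LocalizedModule.mkLinearMap S N) (f.restrictScalars R) hf

theorem mapLocalized_exact {P : Type*} [AddCommGroup P] [Module R P]
    [Module (OperatorRing δ) P] [IsScalarTower R (OperatorRing δ) P]
    {f : M →ₗ[OperatorRing δ] N} {g : N →ₗ[OperatorRing δ] P} (h : Function.Exact f g) :
    Function.Exact (mapLocalized S f) (mapLocalized S g) :=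
  IsLocalizedModule.map_exact S (LocalizedModule.mkLinearMap S M)
    (LocalizedModule.mkLinearMap S N) (LocalizedModule.mkLinearMap S P) (f.restrictScalars R)
    (g.restrictScalars R) h

theorem ker_mapLocalized_le {P : Type*} [AddCommGroup P] [Module R P]
    [Module (OperatorRing δ) P] [IsScalarTower R (OperatorRing δ) P]
    {f : M →ₗ[OperatorRing δ] N} {g : M →ₗ[OperatorRing δ] P}
    (h : LinearMap.ker f ≤ LinearMap.ker g) :
    LinearMap.ker (mapLocalized S f) ≤ LinearMap.ker (mapLocalized S g) := by
  intro x hx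
  obtain ⟨s, hs, m, hm⟩ := exists_smul_eq_toLocalized (δ := δ) x
  have h1 : toLocalized δ S N (f m) = 0 := by
    rw [← mapLocalized_toLocalized, ← hm, mapLocalized_smul, LinearMap.mem_ker.mp hx, smul_zero]
  obtain ⟨t, ht, h2⟩ := (toLocalized_eq_zero_iff _).mp h1
  have h3 : coeff δ t • m ∈ LinearMap.ker g := h (by
    rw [LinearMap.mem_ker, map_smul, coeff_smul, h2])
  refine smul_localized_eq_zero hs (smul_localized_eq_zero ht ?_)
  rw [← mapLocalized_smul, hm, mapLocalized_toLocalized, ← coeff_smul δ t,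
    ← map_smul (toLocalized δ S P), ← map_smul g, LinearMap.mem_ker.mp h3, map_zero]

end Localization

end OperatorRing

/-! ### Modules all of whose localizations at elements are Noetherian -/

open OperatorRing

theorem isNoetherian_of_ker_le {T A B C : Type*} [Ring T] [AddCommGroup A] [Module T A]
    [AddCommGroup B] [Module T B] [AddCommGroup C] [Module T C] (f : A →ₗ[T] B) (g : A →ₗ[T] C)
    (hg : Function.Surjective g) (h : LinearMap.ker f ≤ LinearMap.ker g) [IsNoetherian T B] :
    IsNoetherian T C := by
  have : IsNoetherian T (A ⧸ LinearMap.ker f) :=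
    isNoetherian_of_linearEquiv f.quotKerEquivRange.symm
  exact isNoetherian_of_surjective ((LinearMap.ker f).liftQ g h)
    (by rw [Submodule.range_liftQ]; exact LinearMap.range_eq_top.mpr hg)

section AwayNoetherian

variable {R ι : Type*} [CommRing R] (δ : ι → Derivation ℤ R R)

/-- A module over the operator ring is *away-Noetherian* if its localization at every element of
`R` is Noetherian over the operator ring. -/
def AwayNoetherian (M : Type*) [AddCommGroup M] [Module R M] [Module (OperatorRing δ) M]
    [IsScalarTower R (OperatorRing δ) M] : Prop :=
  ∀ h : R, IsNoetherian (OperatorRing δ) (LocalizedModule (Submonoid.powers h) M)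

namespace AwayNoetherian

variable {δ} {A B C : Type*}
  [AddCommGroup A] [Module R A] [Module (OperatorRing δ) A] [IsScalarTower R (OperatorRing δ) A]
  [AddCommGroup B] [Module R B] [Module (OperatorRing δ) B] [IsScalarTower R (OperatorRing δ) B]
  [AddCommGroup C] [Module R C] [Module (OperatorRing δ) C] [IsScalarTower R (OperatorRing δ) C]

theorem of_ker_le (hB : AwayNoetherian δ B) (f : A →ₗ[OperatorRing δ] B)
    (g : A →ₗ[OperatorRing δ] C) (hg : Function.Surjective g)
    (h : LinearMap.ker f ≤ LinearMap.ker g) : AwayNoetherian δ C := fun r =>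
  have := hB r
  isNoetherian_of_ker_le (mapLocalized _ f) (mapLocalized _ g) (mapLocalized_surjective hg)
    (ker_mapLocalized_le h)

theorem of_surjective (hA : AwayNoetherian δ A) (f : A →ₗ[OperatorRing δ] C)
    (hf : Function.Surjective f) : AwayNoetherian δ C :=
  hA.of_ker_le LinearMap.id f hf (by simp)

theorem of_injective (hB : AwayNoetherian δ B) (f : A →ₗ[OperatorRing δ] B)
    (hf : Function.Injective f) : AwayNoetherian δ A :=
  hB.of_ker_le f LinearMap.id Function.surjective_id
    (by rw [LinearMap.ker_eq_bot.mpr hf]; exact bot_le)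

theorem of_exact (hA : AwayNoetherian δ A) (hC : AwayNoetherian δ C)
    (f : A →ₗ[OperatorRing δ] B) (g : B →ₗ[OperatorRing δ] C) (h : Function.Exact f g) :
    AwayNoetherian δ B := fun r =>
  have := hA r
  have := hC r
  isNoetherian_of_range_eq_ker (mapLocalized _ f) (mapLocalized _ g)
    (mapLocalized_exact h).linearMap_ker_eq.symm

theorem isNoetherian (hA : AwayNoetherian δ A) : IsNoetherian (OperatorRing δ) A := by
  have := hA 1
  refine isNoetherian_of_injective (toLocalized δ (Submonoid.powers (1 : R)) A) ?_
  rw [← LinearMap.ker_eq_bot]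
  refine LinearMap.ker_eq_bot'.mpr fun m hm => ?_
  obtain ⟨s, ⟨n, rfl⟩, hs⟩ := (toLocalized_eq_zero_iff m).mp hm
  simpa using hs

theorem localized (hA : AwayNoetherian δ A) (x : R) :
    AwayNoetherian δ (LocalizedModule (Submonoid.powers x) A) := by
  intro h
  have := hA (x * h)
  have hunit : ∀ t : R, t ∣ x * h → IsUnit (algebraMap R
      (Module.End R (LocalizedModule (Submonoid.powers (x * h)) A)) t) := by
    rintro t ⟨c, hc⟩
    have h1 := IsLocalizedModule.map_units
      (LocalizedModule.mkLinearMap (Submonoid.powers (x * h)) A) ⟨x * h, Submonoid.mem_powers _⟩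
    have hcomm : Commute (algebraMap R (Module.End R
        (LocalizedModule (Submonoid.powers (x * h)) A)) t) (algebraMap R _ c) :=
      Algebra.commutes t _
    rw [show ((⟨x * h, Submonoid.mem_powers _⟩ : Submonoid.powers (x * h)) : R) = t * c from hc,
      map_mul, hcomm.isUnit_mul_iff] at h1
    exact h1.1
  have hx : ∀ s : Submonoid.powers x, IsUnit (algebraMap R
      (Module.End R (LocalizedModule (Submonoid.powers (x * h)) A)) s) := by
    rintro ⟨_, n, rfl⟩
    simpa using! (hunit x (dvd_mul_right _ _)).pow n
  have hh : ∀ s : Submonoid.powers h, IsUnit (algebraMap R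
      (Module.End R (LocalizedModule (Submonoid.powers (x * h)) A)) s) := by
    rintro ⟨_, n, rfl⟩
    simpa using! (hunit h (dvd_mul_left _ _)).pow n
  have inj {U : Submonoid R} (hU : ∀ s : U, IsUnit (algebraMap R
      (Module.End R (LocalizedModule (Submonoid.powers (x * h)) A)) s)) :
      ∀ s ∈ U, ∀ n : LocalizedModule (Submonoid.powers (x * h)) A, s • n = 0 → n = 0 :=
    fun s hs n hn => ((isUnit_algebraMap_end_iff s).mp (hU ⟨s, hs⟩)).1 (hn.trans (smul_zero s).symm)
  let g₁ := LocalizedModule.lift (Submonoid.powers x)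
    (LocalizedModule.mkLinearMap (Submonoid.powers (x * h)) A) hx
  have hg₁ (a : A) : g₁ (toLocalized δ _ A a) = toLocalized δ _ A a :=
    LinearMap.congr_fun (LocalizedModule.lift_comp _ _ hx) a
  let G₁ : LocalizedModule (Submonoid.powers x) A →ₗ[OperatorRing δ]
      LocalizedModule (Submonoid.powers (x * h)) A :=
    linearMapOfCommute g₁ (map_symbol_smul_of_comp g₁ (inj hx) fun i m => by
      rw [hg₁, hg₁, map_smul])
  let g₂ := LocalizedModule.lift (Submonoid.powers h) (G₁.restrictScalars R) hh
  have hg₂ (a : LocalizedModule (Submonoid.powers x) A) : g₂ (toLocalized δ _ _ a) = G₁ a :=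
    LinearMap.congr_fun (LocalizedModule.lift_comp _ _ hh) a
  let G₂ : LocalizedModule (Submonoid.powers h) (LocalizedModule (Submonoid.powers x) A)
      →ₗ[OperatorRing δ] LocalizedModule (Submonoid.powers (x * h)) A :=
    linearMapOfCommute g₂ (map_symbol_smul_of_comp g₂ (inj hh) fun i m => by
      rw [hg₂, hg₂, map_smul])
  refine isNoetherian_of_injective G₂ (LinearMap.ker_eq_bot.mp (LinearMap.ker_eq_bot'.mpr ?_))
  intro y (hy : g₂ y = 0)
  obtain ⟨s, hs, z, hz⟩ := exists_smul_eq_toLocalized (δ := δ) y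
  obtain ⟨t, ht, a, ha⟩ := exists_smul_eq_toLocalized (δ := δ) z
  have h1 : g₁ z = 0 := by
    change G₁ z = 0
    rw [← hg₂, ← hz, map_smul, hy, smul_zero]
  have h2 : toLocalized δ (Submonoid.powers (x * h)) A a = 0 := by
    rw [← hg₁, ← ha, map_smul, h1, smul_zero]
  obtain ⟨_, ⟨n, rfl⟩, h3⟩ := (toLocalized_eq_zero_iff a).mp h2
  have h4 : toLocalized δ (Submonoid.powers x) A (h ^ n • a) = 0 :=
    (toLocalized_eq_zero_iff _).mpr ⟨x ^ n, ⟨n, rfl⟩, by rw [← mul_smul, ← mul_pow]; exact h3⟩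
  have h5 : h ^ n • z = 0 := by
    refine smul_localized_eq_zero ht ?_
    rw [smul_comm, ha, ← h4, ← coeff_smul δ, ← coeff_smul δ, map_smul]
  exact smul_localized_eq_zero hs (hz.trans
    ((toLocalized_eq_zero_iff z).mpr ⟨h ^ n, ⟨n, rfl⟩, h5⟩))

end AwayNoetherian

end AwayNoetherian

/-! ### Sections supported on an ideal, and finiteness of associated primes -/

section Torsion

variable {R ι : Type*} [CommRing R]

theorem derivation_mem_pow (d : Derivation ℤ R R) (I : Ideal R) (k : ℕ) {a : R}
    (ha : a ∈ I ^ (k + 1)) : d a ∈ I ^ k := by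
  induction k generalizing a with
  | zero => simp
  | succ k ih =>
    rw [pow_succ] at ha
    induction ha using Submodule.mul_induction_on' with
    | mem_mul_mem b hb c hc =>
      rw [d.leibniz]
      refine add_mem ((I ^ (k + 1)).mul_mem_right _ hb) ?_
      rw [smul_eq_mul, mul_comm, pow_succ]
      exact Ideal.mul_mem_mul (ih hb) hc
    | add b _ c _ hb hc => rw [map_add]; exact add_mem hb hc

variable (δ : ι → Derivation ℤ R R) (I : Ideal R)
  (M : Type*) [AddCommGroup M] [Module R M] [Module (OperatorRing δ) M]
  [IsScalarTower R (OperatorRing δ) M]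

/-- `Γ_I(M)`, the elements of `M` annihilated by a power of `I`. It is stable under the operators
because a derivation maps `I ^ (k + 1)` to `I ^ k`. -/
def torsion : Submodule (OperatorRing δ) M :=
  submoduleOfStable
    { carrier := {m | ∃ k : ℕ, ∀ a ∈ I ^ k, a • m = (0 : M)}
      zero_mem' := ⟨0, fun a _ => smul_zero a⟩
      add_mem' := by
        rintro m n ⟨k, hk⟩ ⟨l, hl⟩
        refine ⟨k + l, fun a ha => ?_⟩
        rw [smul_add, hk a (Ideal.pow_le_pow_right (Nat.le_add_right k l) ha),
          hl a (Ideal.pow_le_pow_right (Nat.le_add_left l k) ha), add_zero]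
      smul_mem' := by
        rintro r m ⟨k, hk⟩
        exact ⟨k, fun a ha => by rw [smul_comm, hk a ha, smul_zero]⟩ } <| by
    rintro i m ⟨k, hk⟩
    refine ⟨k + 1, fun a ha => ?_⟩
    have h := symbol_smul_smul δ i a m
    rwa [hk a (Ideal.pow_le_pow_right k.le_succ ha), smul_zero,
      hk _ (derivation_mem_pow (δ i) I k ha), zero_add, eq_comm] at h

variable {δ I M}

theorem torsion_anti {J : Ideal R} (h : I ≤ J) : torsion δ J M ≤ torsion δ I M := by
  rintro m ⟨k, hk⟩
  exact ⟨k, fun a ha => hk a (Ideal.pow_right_mono h k ha)⟩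

theorem mem_torsion_sup {x : R} {m : M} (hm : m ∈ torsion δ I M) {n : ℕ} (hx : x ^ n • m = 0) :
    m ∈ torsion δ (I ⊔ Ideal.span {x}) M := by
  obtain ⟨k, hk⟩ := hm
  refine ⟨k + n, fun a ha => ?_⟩
  obtain ⟨b, hb, c, hc, rfl⟩ := Submodule.mem_sup.mp (Ideal.sup_pow_add_le_pow_sup_pow ha)
  rw [Ideal.span_singleton_pow] at hc
  obtain ⟨c, rfl⟩ := Ideal.mem_span_singleton'.mp hc
  rw [add_smul, hk b hb, mul_smul, hx, smul_zero, add_zero]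

theorem exists_pow_smul_eq_zero {x : R} {m : M}
    (hm : m ∈ torsion δ (I ⊔ Ideal.span {x}) M) : ∃ n : ℕ, x ^ n • m = 0 := by
  obtain ⟨k, hk⟩ := hm
  exact ⟨k, hk _ (Ideal.pow_mem_pow (Ideal.mem_sup_right (Ideal.mem_span_singleton_self x)) k)⟩

theorem torsion_bot : torsion δ (⊥ : Ideal R) M = ⊤ := by
  refine eq_top_iff.mpr fun m _ => ⟨1, fun a ha => ?_⟩
  rw [pow_one, Ideal.mem_bot] at ha
  rw [ha, zero_smul]

variable {N : Type*} [AddCommGroup N] [Module R N] [Module (OperatorRing δ) N]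
  [IsScalarTower R (OperatorRing δ) N]

theorem smul_map (f : M →ₗ[OperatorRing δ] N) (r : R) (m : M) : f (r • m) = r • f m :=
  map_smul (f.restrictScalars R) r m

variable (I) in
/-- The functor `Γ_I` on linear maps. -/
def torsionMap (f : M →ₗ[OperatorRing δ] N) : torsion δ I M →ₗ[OperatorRing δ] torsion δ I N :=
  f.restrict (by
    rintro m ⟨k, hk⟩
    exact ⟨k, fun a ha => by rw [← smul_map, hk a ha, map_zero]⟩)

/-- An associated prime of `Γ_P(M)` contains `P`. -/
theorem le_of_isAssociatedPrime_torsion [IsNoetherianRing R] {P Q : Ideal R}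
    (h : IsAssociatedPrime Q (torsion δ P M)) : P ≤ Q := by
  obtain ⟨hQ, ⟨m, k, hk⟩, rfl⟩ := (isAssociatedPrime_iff).mp h
  refine (hQ.pow_le_iff (n := k + 1) k.succ_ne_zero).mp fun a ha => ?_
  rw [Submodule.mem_colon_singleton, Submodule.mem_bot]
  exact Subtype.ext (hk a (Ideal.pow_le_pow_right k.le_succ ha))

/-- A Noetherian module over the operator ring has finitely many associated primes over `R`: for
a maximal associated prime `P`, the submodule `Γ_P(M)` is nonzero with `P` as its only associated
prime, and passing to `M / Γ_P(M)` stops after finitely many steps. -/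
theorem finite_associatedPrimes [IsNoetherianRing R] [IsNoetherian (OperatorRing δ) M] :
    (associatedPrimes R M).Finite := by
  suffices H : ∀ N : Submodule (OperatorRing δ) M, (associatedPrimes R (M ⧸ N)).Finite by
    refine (H ⊥).subset (associatedPrimes.subset_of_injective
      (f := ((⊥ : Submodule (OperatorRing δ) M).mkQ).restrictScalars R) ?_)
    exact LinearMap.ker_eq_bot.mp (Submodule.ker_mkQ ⊥)
  intro N
  induction N using WellFoundedGT.induction with
  | ind N ih =>
    rcases subsingleton_or_nontrivial (M ⧸ N) with hs | hs
    · rw [associatedPrimes.eq_empty_of_subsingleton]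
      exact Set.finite_empty
    · obtain ⟨P, hP, hmax⟩ := set_has_maximal_iff_noetherian.mpr
        (inferInstanceAs (IsNoetherian R R)) _ (associatedPrimes.nonempty R (M ⧸ N))
      let G : Submodule (OperatorRing δ) (M ⧸ N) := torsion δ P (M ⧸ N)
      have hNG : N < G.comap N.mkQ := by
        refine lt_of_le_of_ne (fun m hm => ?_) fun heq => ?_
        · have : N.mkQ m = 0 := (Submodule.Quotient.mk_eq_zero N).mpr hm
          rw [Submodule.mem_comap, this]
          exact G.zero_mem
        · obtain ⟨hPp, y, hy⟩ := (isAssociatedPrime_iff).mp hP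
          obtain ⟨y, rfl⟩ := N.mkQ_surjective y
          have hyG : y ∈ G.comap N.mkQ := ⟨1, fun a ha => by
            rw [pow_one, hy] at ha
            exact (Submodule.mem_bot R).mp (Submodule.mem_colon_singleton.mp ha)⟩
          rw [← heq] at hyG
          have hy0 : N.mkQ y = 0 := (Submodule.Quotient.mk_eq_zero N).mpr hyG
          refine hPp.ne_top ((Ideal.eq_top_iff_one P).mpr ?_)
          rw [hy, hy0, Submodule.mem_colon_singleton]
          simp
      have hker : LinearMap.ker (N.mapQ (G.comap N.mkQ) LinearMap.id hNG.le) = G := by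
        ext z
        obtain ⟨z, rfl⟩ := N.mkQ_surjective z
        rw [LinearMap.mem_ker, Submodule.mkQ_apply, Submodule.mapQ_apply, LinearMap.id_apply,
          Submodule.Quotient.mk_eq_zero, Submodule.mem_comap, Submodule.mkQ_apply]
      refine ((Set.finite_singleton P).union (ih _ hNG)).subset
        ((associatedPrimes.subset_union_of_exact (f := G.subtype.restrictScalars R)
          (g := (N.mapQ (G.comap N.mkQ) LinearMap.id hNG.le).restrictScalars R)
          Subtype.val_injective fun z => ?_).trans (Set.union_subset_union_left _ ?_))
      · change z ∈ LinearMap.ker (N.mapQ (G.comap N.mkQ) LinearMap.id hNG.le) ↔ _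
        rw [hker]
        exact ⟨fun h => ⟨⟨z, h⟩, rfl⟩, fun ⟨w, hw⟩ => hw ▸ w.2⟩
      · intro Q hQ
        have hQ' : IsAssociatedPrime Q (M ⧸ N) :=
          hQ.map_of_injective (G.subtype.restrictScalars R) Subtype.val_injective
        exact (le_of_isAssociatedPrime_torsion hQ).eq_of_not_lt (hmax Q hQ') |>.symm

end Torsion

/-! ### Local cohomology modules of modules over the operator ring -/

section Injective

variable {R ι : Type u} [CommRing R] [IsNoetherianRing R] {δ : ι → Derivation ℤ R R}
  {I : Ideal R} {E : Type u} [AddCommGroup E] [Module R E] [Module (OperatorRing δ) E]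
  [IsScalarTower R (OperatorRing δ) E] [Module.Injective R E]

/-- For an injective module `E` the map from `Γ_I(E)` to its localization at `x` is surjective.
If `I ^ k` annihilates `e`, and the ideals `(I ^ k : x ^ m)` are stationary from `m` on, then
`x ^ (n + m) ↦ x ^ m e` is well defined on the image of `x ^ (n + m)` in `R / I ^ k` and extends
to `R / I ^ k`. -/
theorem toLocalized_torsion_surjective (x : R) :
    Function.Surjective (toLocalized δ (Submonoid.powers x) (torsion δ I E)) := by
  intro y
  obtain ⟨_, ⟨n, rfl⟩, ⟨e, k, hk⟩, he⟩ := exists_smul_eq_toLocalized (δ := δ) y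
  let c : ℕ →o Ideal R :=
    { toFun := fun m => LinearMap.ker ((I ^ k).mkQ ∘ₗ LinearMap.mulLeft R (x ^ m))
      monotone' := by
        intro a b hab r hr
        simp only [LinearMap.mem_ker, LinearMap.comp_apply, LinearMap.mulLeft_apply,
          Submodule.mkQ_apply, Submodule.Quotient.mk_eq_zero] at hr ⊢
        rw [← Nat.add_sub_of_le hab, pow_add, mul_right_comm]
        exact Ideal.mul_mem_right _ _ hr }
  obtain ⟨m, hm⟩ := monotone_stabilizes_iff_noetherian.mpr (inferInstanceAs (IsNoetherian R R)) c
  have hc {r : R} : r ∈ c (n + m) ↔ x ^ m * r ∈ I ^ k := by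
    rw [← hm (n + m) (Nat.le_add_left m n)]
    change r ∈ LinearMap.ker _ ↔ _
    simp only [LinearMap.mem_ker, LinearMap.comp_apply, LinearMap.mulLeft_apply,
      Submodule.mkQ_apply, Submodule.Quotient.mk_eq_zero]
  let φ := (c (n + m)).liftQ ((I ^ k).mkQ ∘ₗ LinearMap.mulLeft R (x ^ (n + m))) le_rfl
  have hφ : Function.Injective φ :=
    LinearMap.ker_eq_bot.mp (Submodule.ker_liftQ_eq_bot' _ _ rfl)
  let g := (c (n + m)).liftQ (LinearMap.toSpanSingleton R E (x ^ m • e)) fun r hr => by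
    rw [LinearMap.mem_ker, LinearMap.toSpanSingleton_apply, ← mul_smul, mul_comm]
    exact hk _ (hc.mp hr)
  obtain ⟨h, hh⟩ := Module.Injective.out φ hφ g
  have hh1 : x ^ (n + m) • h ((I ^ k).mkQ 1) = x ^ m • e := by
    have h1 := hh (Submodule.Quotient.mk 1)
    rw [Submodule.liftQ_apply, Submodule.liftQ_apply, LinearMap.toSpanSingleton_apply,
      one_smul] at h1
    rw [← h1, ← map_smul, ← map_smul, LinearMap.comp_apply, LinearMap.mulLeft_apply,
      smul_eq_mul]
  let e' : torsion δ I E := ⟨h ((I ^ k).mkQ 1), k, fun a ha => by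
    rw [← map_smul, ← map_smul, smul_eq_mul, mul_one,
      show (I ^ k).mkQ a = 0 from (Submodule.Quotient.mk_eq_zero (I ^ k)).mpr ha, map_zero]⟩
  refine ⟨e', ?_⟩
  have h2 : x ^ (n + m) • e' = x ^ m • (⟨e, k, hk⟩ : torsion δ I E) := Subtype.ext hh1
  refine (smul_localized_bijective (Submonoid.mem_powers_iff _ _ |>.mpr ⟨n + m, rfl⟩)).1 ?_
  change x ^ (n + m) • toLocalized δ (Submonoid.powers x) _ e' = x ^ (n + m) • y
  rw [← smul_map, h2, smul_map, ← he, ← mul_smul, ← pow_add, add_comm]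

end Injective

section CohomologyStep

variable {R ι : Type u} [CommRing R] {δ : ι → Derivation ℤ R R}
variable {E M E' M' : Type u}
  [AddCommGroup E] [Module R E] [Module (OperatorRing δ) E] [IsScalarTower R (OperatorRing δ) E]
  [AddCommGroup M] [Module R M] [Module (OperatorRing δ) M] [IsScalarTower R (OperatorRing δ) M]
  [AddCommGroup E'] [Module R E'] [Module (OperatorRing δ) E']
  [IsScalarTower R (OperatorRing δ) E']
  [AddCommGroup M'] [Module R M'] [Module (OperatorRing δ) M']
  [IsScalarTower R (OperatorRing δ) M']

/-- The module `Γ_I(M) / π(Γ_I(E))` for a linear map `π : E → M`. If `M` is the `i`-th cosyzygy in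
an injective resolution, and `π` the projection from the preceding injective module, this is the
`i`-th local cohomology module. -/
abbrev TorsionQuotient (I : Ideal R) (π : E →ₗ[OperatorRing δ] M) : Type u :=
  torsion δ I M ⧸ LinearMap.range (torsionMap I π)

/-- The map of torsion quotients induced by an inclusion of ideals. -/
def TorsionQuotient.restrict {I J : Ideal R} (h : I ≤ J) (π : E →ₗ[OperatorRing δ] M) :
    TorsionQuotient J π →ₗ[OperatorRing δ] TorsionQuotient I π :=
  Submodule.mapQ _ _ (Submodule.inclusion (torsion_anti h)) (by
    rintro _ ⟨e, rfl⟩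
    exact ⟨Submodule.inclusion (torsion_anti h) e, rfl⟩)

theorem TorsionQuotient.restrict_mk_eq_zero {I J : Ideal R} (h : I ≤ J)
    (π : E →ₗ[OperatorRing δ] M) (m : torsion δ J M) :
    TorsionQuotient.restrict h π (Submodule.Quotient.mk m) = 0 ↔
      ∃ e ∈ torsion δ I E, π e = m := by
  rw [TorsionQuotient.restrict, Submodule.mapQ_apply, Submodule.Quotient.mk_eq_zero]
  constructor
  · rintro ⟨e, he⟩
    exact ⟨e, e.2, congrArg Subtype.val he⟩
  · rintro ⟨e, he, hm⟩
    exact ⟨⟨e, he⟩, Subtype.ext hm⟩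

/-- The inductive step over the number of generators of the ideal. It replaces the exact sequence
`H^i_I(M)_x → H^{i+1}_{I + (x)}(M) → H^{i+1}_I(M)`: the kernel of the second map is a quotient of a
submodule of `H^i_I(M)_x`. -/
theorem awayNoetherian_torsionQuotient_sup [IsNoetherianRing R] [Module.Injective R E]
    (I : Ideal R) (x : R) (π : E →ₗ[OperatorRing δ] M) (j : M →ₗ[OperatorRing δ] E')
    (π' : E' →ₗ[OperatorRing δ] M') (hj : Function.Injective j) (hex : Function.Exact j π')
    (h : AwayNoetherian δ (TorsionQuotient I π))
    (h' : AwayNoetherian δ (TorsionQuotient I π')) :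
    AwayNoetherian δ (TorsionQuotient (I ⊔ Ideal.span {x}) π') := by
  let S := Submonoid.powers x
  let J := I ⊔ Ideal.span {x}
  have hIJ : I ≤ J := le_sup_left
  let res := TorsionQuotient.restrict hIJ π'
  refine AwayNoetherian.of_exact (A := LinearMap.ker res) ?_ h' (LinearMap.ker res).subtype res
    (LinearMap.exact_subtype_ker_map res)
  -- pairs `(w, y)` with `w / 1 = y` in the localization and `π' w` annihilated by a power of `J`
  let A : Submodule (OperatorRing δ)
      (torsion δ I E' × LocalizedModule S (torsion δ I M)) :=
    LinearMap.ker (toLocalized δ S (torsion δ I E') ∘ₗ LinearMap.fst _ _ _ -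
      mapLocalized S (torsionMap I j) ∘ₗ LinearMap.snd _ _ _) ⊓
    (torsion δ J M').comap (π' ∘ₗ (torsion δ I E').subtype ∘ₗ LinearMap.fst _ _ _)
  have hA (p : A) : toLocalized δ S (torsion δ I E') p.1.1 =
      mapLocalized S (torsionMap I j) p.1.2 := sub_eq_zero.mp p.2.1
  let f : A →ₗ[OperatorRing δ] LocalizedModule S (TorsionQuotient I π) :=
    mapLocalized S (LinearMap.range (torsionMap I π)).mkQ ∘ₗ LinearMap.snd _ _ _ ∘ₗ A.subtype
  let g₀ : A →ₗ[OperatorRing δ] torsion δ J M' :=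
    (π' ∘ₗ (torsion δ I E').subtype ∘ₗ LinearMap.fst _ _ _ ∘ₗ A.subtype).codRestrict _
      fun p => p.2.2
  let g : A →ₗ[OperatorRing δ] LinearMap.ker res :=
    ((LinearMap.range (torsionMap J π')).mkQ ∘ₗ g₀).codRestrict _ fun p =>
      (TorsionQuotient.restrict_mk_eq_zero hIJ π' (g₀ p)).mpr ⟨p.1.1, p.1.1.2, rfl⟩
  refine AwayNoetherian.of_ker_le (A := A) (C := LinearMap.ker res) (h.localized x) f g ?_ ?_
  · rintro ⟨z, hz⟩
    obtain ⟨c, rfl⟩ := Submodule.mkQ_surjective _ z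
    obtain ⟨e, he, hec⟩ := (TorsionQuotient.restrict_mk_eq_zero hIJ π' c).mp hz
    obtain ⟨n, hn⟩ := exists_pow_smul_eq_zero c.2
    obtain ⟨m, hm⟩ := (hex (x ^ n • e)).mp (by rw [smul_map, hec, hn])
    have hmt : m ∈ torsion δ I M := by
      obtain ⟨k, hk⟩ := (torsion δ I E').smul_of_tower_mem (x ^ n) he
      exact ⟨k, fun a ha => hj (by rw [smul_map, hm, hk a ha, map_zero])⟩
    have hS : x ^ n ∈ S := ⟨n, rfl⟩
    obtain ⟨y, hy⟩ := (smul_localized_bijective hS).2 (toLocalized δ S _ (⟨m, hmt⟩ : torsion δ I M))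
    have hy' : x ^ n • y = toLocalized δ S _ (⟨m, hmt⟩ : torsion δ I M) := hy
    refine ⟨⟨(⟨e, he⟩, y), sub_eq_zero.mpr ?_, ?_⟩, Subtype.ext ?_⟩
    · refine (smul_localized_bijective hS).1 ?_
      change x ^ n • toLocalized δ S (torsion δ I E') ⟨e, he⟩ =
        x ^ n • mapLocalized S (torsionMap I j) y
      rw [← smul_map, ← smul_map, hy', mapLocalized_toLocalized]
      exact congrArg _ (Subtype.ext hm.symm)
    · change π' e ∈ torsion δ J M'
      rw [hec]
      exact c.2
    · exact congrArg (LinearMap.range (torsionMap J π')).mkQ (Subtype.ext hec)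
  · intro p hp
    have hp' : mapLocalized S (LinearMap.range (torsionMap I π)).mkQ p.1.2 = 0 := hp
    obtain ⟨y, hy⟩ := (mapLocalized_exact (S := S) (LinearMap.exact_map_mkQ_range
      (torsionMap I π)) p.1.2).mp hp'
    obtain ⟨e, rfl⟩ := toLocalized_torsion_surjective x y
    rw [mapLocalized_toLocalized] at hy
    have h1 : toLocalized δ S (torsion δ I E') (p.1.1 - torsionMap I j (torsionMap I π e)) = 0 := by
      rw [map_sub, hA p, ← hy, mapLocalized_toLocalized, sub_self]
    obtain ⟨_, ⟨n, rfl⟩, hn⟩ := (toLocalized_eq_zero_iff _).mp h1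
    refine LinearMap.mem_ker.mpr (Subtype.ext ((Submodule.Quotient.mk_eq_zero _).mpr ?_))
    refine ⟨⟨_, mem_torsion_sup (p.1.1 - torsionMap I j (torsionMap I π e)).2
      (congrArg Subtype.val hn)⟩, Subtype.ext ?_⟩
    change π' (p.1.1 - j (π e)) = π' p.1.1
    rw [map_sub, hex.apply_apply_eq_zero, sub_zero]

end CohomologyStep

/-! ### Injective resolutions by modules over the operator ring -/

section Stage

variable {R ι : Type u} [CommRing R] (δ : ι → Derivation ℤ R R)

/-- One stage of an injective resolution by modules over the operator ring: an `R`-injective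
module `E` with a linear map `π` to a module `M`. -/
structure Stage where
  /-- The injective module. -/
  E : Type u
  /-- The target of the projection. -/
  M : Type u
  [addCommGroupE : AddCommGroup E]
  [moduleE : Module R E]
  [operatorE : Module (OperatorRing δ) E]
  [towerE : IsScalarTower R (OperatorRing δ) E]
  [addCommGroupM : AddCommGroup M]
  [moduleM : Module R M]
  [operatorM : Module (OperatorRing δ) M]
  [towerM : IsScalarTower R (OperatorRing δ) M]
  /-- The projection. -/
  π : E →ₗ[OperatorRing δ] M
  injective : Module.Injective R E

namespace Stage

attribute [instance] addCommGroupE moduleE operatorE towerE addCommGroupM moduleM operatorM towerM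
  injective

variable {δ}

/-- Two stages follow each other in a resolution if there is a short exact sequence
`0 → S.M → S'.E → S'.M → 0`. -/
def Next (S S' : Stage δ) : Prop :=
  ∃ j : S.M →ₗ[OperatorRing δ] S'.E,
    Function.Injective j ∧ Function.Exact j S'.π ∧ Function.Surjective S'.π

theorem exists_next (S : Stage δ) : ∃ S' : Stage δ, S.Next S' := by
  obtain ⟨E, _, _, _, _, φ, hE, hφ⟩ := exists_injective_embedding δ S.M
  exact ⟨⟨E, E ⧸ LinearMap.range φ, (LinearMap.range φ).mkQ, hE⟩, φ, hφ,
    LinearMap.exact_map_mkQ_range φ, Submodule.mkQ_surjective _⟩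

variable (δ) in
/-- The initial stage `0 → M`. -/
def ofModule (M : Type u) [AddCommGroup M] [Module R M] [Module (OperatorRing δ) M]
    [IsScalarTower R (OperatorRing δ) M] : Stage δ :=
  ⟨PUnit, M, 0, ⟨fun _ _ _ _ _ _ _ _ _ => ⟨0, fun _ => rfl⟩⟩⟩

variable (δ) in
/-- Every module over the operator ring has a resolution by modules injective over `R`. Its stages
are the maps from the injective modules to the cosyzygies, beginning with `0 → M`. -/
theorem exists_resolution (M : Type u) [AddCommGroup M] [Module R M] [Module (OperatorRing δ) M]
    [IsScalarTower R (OperatorRing δ) M] :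
    ∃ F : ℕ → Stage δ, F 0 = ofModule δ M ∧ ∀ n, (F n).Next (F (n + 1)) := by
  choose next hnext using exists_next (δ := δ)
  exact ⟨Nat.rec (ofModule δ M) fun _ S => next S, rfl, fun n => hnext _⟩

theorem awayNoetherian_of_subsingleton (M : Type*) [AddCommGroup M] [Module R M]
    [Module (OperatorRing δ) M] [IsScalarTower R (OperatorRing δ) M] [Subsingleton M] :
    AwayNoetherian δ M := fun _ => inferInstance

/-- The local cohomology modules of an away-Noetherian module are away-Noetherian. -/
theorem awayNoetherian_torsionQuotient [IsNoetherianRing R] (F : ℕ → Stage δ)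
    (hF : ∀ n, (F n).Next (F (n + 1))) (h₀ : AwayNoetherian δ (F 0).M) (I : Ideal R) (n : ℕ) :
    AwayNoetherian δ (TorsionQuotient I (F n).π) := by
  have hzero (J : Ideal R) : AwayNoetherian δ (TorsionQuotient J (F 0).π) :=
    (h₀.of_injective (torsion δ J (F 0).M).subtype Subtype.val_injective).of_surjective
      (LinearMap.range (torsionMap J (F 0).π)).mkQ (Submodule.mkQ_surjective _)
  classical
  obtain ⟨s, rfl⟩ : I.FG := IsNoetherian.noetherian I
  induction s using Finset.induction_on generalizing n with
  | empty =>
    cases n with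
    | zero => exact hzero _
    | succ n =>
      obtain ⟨j, -, -, hπ⟩ := hF n
      have : Subsingleton (TorsionQuotient (Ideal.span ((∅ : Finset R) : Set R)) (F (n + 1)).π) := by
        rw [Submodule.Quotient.subsingleton_iff, LinearMap.range_eq_top]
        intro m
        obtain ⟨e, he⟩ := hπ m
        refine ⟨⟨e, ?_⟩, Subtype.ext he⟩
        rw [Finset.coe_empty, Ideal.span_empty, torsion_bot]
        trivial
      exact awayNoetherian_of_subsingleton _
  | insert x s _ ih =>
    cases n with
    | zero => exact hzero _
    | succ n =>
      obtain ⟨j, hj, hex, -⟩ := hF n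
      have h := awayNoetherian_torsionQuotient_sup (Ideal.span (s : Set R)) x (F n).π j
        (F (n + 1)).π hj hex (ih n) (ih (n + 1))
      rwa [sup_comm, ← Ideal.span_insert, ← Finset.coe_insert] at h

end Stage

end Stage

/-! ### Comparison of the derived functor `Ext` with Yoneda `Ext` groups -/

section ExtComparison

open CategoryTheory Opposite

variable {R : Type*} [CommRing R] {C : Type*} [Category C] [Abelian C] [Linear R C]

/-- A morphism of chain complexes induces a morphism between the complexes of morphisms to `Y`. -/
def linearYonedaObjMap {K L : ChainComplex C ℕ} (φ : K ⟶ L) (Y : C) :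
    L.linearYonedaObj R Y ⟶ K.linearYonedaObj R Y where
  f i := ModuleCat.ofHom (Linear.leftComp R Y (φ.f i))
  comm' i j _ := by
    ext f
    have h (f : L.X i ⟶ Y) : φ.f j ≫ L.d j i ≫ f = K.d j i ≫ φ.f i ≫ f := by
      rw [← Category.assoc, ← Category.assoc, φ.comm]
    exact (h f).symm

/-- Passing from a commutative square in an opposite category to one in the category itself. -/
theorem unop_comp_eq {D : Type*} [Category D] {X X' L L' : Dᵒᵖ} {H H' : D} {p' : L' ⟶ X'}
    {m : X' ⟶ X} {k : L' ⟶ L} {p : L ⟶ X} {c : H ⟶ H'} (a : L ≅ op H) (a' : L' ≅ op H')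
    (h₁ : p' ≫ m = k ≫ p) (h₂ : k ≫ a.hom = a'.hom ≫ c.op) :
    m.unop ≫ p'.unop ≫ a'.inv.unop = (p.unop ≫ a.inv.unop) ≫ c := by
  apply Quiver.Hom.op_inj
  change (a'.inv ≫ p') ≫ m = c.op ≫ a.inv ≫ p
  rw [Category.assoc, h₁, ← Category.assoc, ← Category.assoc]
  congr 1
  rw [Iso.inv_comp_eq, ← Category.assoc, ← h₂, Category.assoc, Iso.hom_inv_id, Category.comp_id]

/-- The computation of the derived functor `Ext` by a projective resolution is natural with respect
to morphisms of resolutions. -/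
theorem ext_map_comp_isoExt_hom [EnoughProjectives C] {X X' : C} {P : ProjectiveResolution X}
    {P' : ProjectiveResolution X'} {g : X' ⟶ X} (φ : ProjectiveResolution.Hom P' P g) (n : ℕ)
    (Y : C) :
    ((_root_.Ext R C n).map g.op).app Y ≫ (P'.isoExt n Y).hom =
      (P.isoExt n Y).hom ≫ HomologicalComplex.homologyMap (linearYonedaObjMap φ.hom Y) n := by
  let F := ((linearYoneda R C).obj Y).rightOp
  have h1 := ProjectiveResolution.isoLeftDerivedObj_inv_naturality g P' P φ.hom
    (by simpa using φ.hom_f_zero_comp_π_f_zero) F n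
  have h2 := HomologicalComplex.homologyOp_hom_naturality
    (linearYonedaObjMap (R := R) φ.hom Y) n
  have h2' : ((F.mapHomologicalComplex _ ⋙ HomologicalComplex.homologyFunctor _ _ n).map φ.hom) ≫
      (HomologicalComplex.homologyOp (P.complex.linearYonedaObj R Y) n).hom =
      (HomologicalComplex.homologyOp (P'.complex.linearYonedaObj R Y) n).hom ≫
        (HomologicalComplex.homologyMap (linearYonedaObjMap (R := R) φ.hom Y) n).op := h2
  have h3 : ((_root_.Ext R C n).map g.op).app Y = ((F.leftDerived n).map g).unop := rfl
  have h4 (X : C) (P : ProjectiveResolution X) : (P.isoExt n Y).hom =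
      (P.isoLeftDerivedObj F n).inv.unop ≫
        (HomologicalComplex.homologyOp (P.complex.linearYonedaObj R Y) n).inv.unop := rfl
  rw [h3, h4, h4]
  exact unop_comp_eq _ _ h1 h2'

/-- The class in the homology of a short complex of modules of an element killed by the second
map. -/
def homologyClass (S : ShortComplex (ModuleCat R)) : LinearMap.ker S.g.hom →ₗ[R] S.homology :=
  (S.moduleCatCyclesIso.inv ≫ S.homologyπ).hom

theorem homologyClass_surjective (S : ShortComplex (ModuleCat R)) :
    Function.Surjective (homologyClass S) :=
  (ModuleCat.epi_iff_surjective _).mp inferInstance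

theorem homologyClass_eq_zero_iff (S : ShortComplex (ModuleCat R)) (z : LinearMap.ker S.g.hom) :
    homologyClass S z = 0 ↔ ∃ x, S.f.hom x = z := by
  rw [homologyClass, S.moduleCatCyclesIso_inv_π]
  have hinj : Function.Injective S.moduleCatHomologyIso.inv.hom :=
    (ModuleCat.mono_iff_injective _).mp inferInstance
  refine (map_eq_zero_iff _ hinj).trans ((Submodule.Quotient.mk_eq_zero _).trans ?_)
  exact ⟨fun ⟨x, hx⟩ => ⟨x, congrArg Subtype.val hx⟩,
    fun ⟨x, hx⟩ => ⟨x, Subtype.ext hx⟩⟩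

theorem iCycles_moduleCatCyclesIso_inv (S : ShortComplex (ModuleCat R))
    (z : LinearMap.ker S.g.hom) : S.iCycles.hom (S.moduleCatCyclesIso.inv.hom z) = z :=
  congrArg (fun f => f.hom z) S.moduleCatCyclesIso_inv_iCycles

theorem homologyMap_homologyClass {S S' : ShortComplex (ModuleCat R)} (φ : S ⟶ S')
    (z : LinearMap.ker S.g.hom) (z' : LinearMap.ker S'.g.hom) (h : φ.τ₂.hom z = z') :
    (ShortComplex.homologyMap φ).hom (homologyClass S z) = homologyClass S' z' := by
  have h1 : (ShortComplex.cyclesMap φ).hom (S.moduleCatCyclesIso.inv.hom z) =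
      S'.moduleCatCyclesIso.inv.hom z' := by
    have hinj : Function.Injective S'.iCycles.hom :=
      (ModuleCat.mono_iff_injective _).mp inferInstance
    apply hinj
    rw [iCycles_moduleCatCyclesIso_inv, ← h]
    have := congrArg (fun f => f.hom (S.moduleCatCyclesIso.inv.hom z))
      (ShortComplex.cyclesMap_i φ)
    refine this.trans ?_
    exact congrArg φ.τ₂.hom (iCycles_moduleCatCyclesIso_inv S z)
  have h2 := congrArg (fun f => f.hom (S.moduleCatCyclesIso.inv.hom z))
    (ShortComplex.homologyπ_naturality φ)
  refine h2.trans ?_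
  exact congrArg S'.homologyπ.hom h1

/-- In degree zero the cocycle representing an element of `Ext X Y 0` is unique. -/
theorem extMk_zero_injective [HasExt C] {X Y : C} (P : ProjectiveResolution X)
    (f : P.complex.X 0 ⟶ Y) (m : ℕ) (hm : 0 + 1 = m) (hf : P.complex.d m 0 ≫ f = 0)
    (h : P.extMk f m hm hf = 0) : f = 0 := by
  rw [← P.extEquivCohomologyClass.apply_eq_iff_eq,
    ProjectiveResolution.extEquivCohomologyClass_extMk,
    ProjectiveResolution.extEquivCohomologyClass_zero,
    CochainComplex.HomComplex.CohomologyClass.mk_eq_zero_iff,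
    CochainComplex.HomComplex.Cocycle.toSingleMk_mem_coboundaries_iff _ _ _ _ _ 1 (by simp)] at h
  obtain ⟨g, hg⟩ := h
  have h0 : P.cochainComplex.d (-(0 : ℕ)) 1 = 0 := by
    apply Limits.IsZero.eq_of_tgt
    exact CochainComplex.isZero_of_isStrictlyLE _ 0 1
  rw [h0, Limits.zero_comp] at hg
  rw [← cancel_epi (P.cochainComplexXIso (-(0 : ℕ)) 0 rfl).hom, ← hg, Limits.comp_zero]

theorem extMk_congr [HasExt C] {X Y : C} (P : ProjectiveResolution X) {n : ℕ}
    {f f' : P.complex.X n ⟶ Y} (h : f = f') (m : ℕ) (hm : n + 1 = m)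
    (hf : P.complex.d m n ≫ f = 0) :
    P.extMk f m hm hf = P.extMk f' m hm (h ▸ hf) := by
  subst h
  rfl

section Cocycles

variable {X : C} (P : ProjectiveResolution X) (Y : C) (n : ℕ)

variable (R) in
/-- The short complex around degree `n` of the complex of morphisms from a projective resolution
to `Y`. -/
abbrev yonedaSc : ShortComplex (ModuleCat R) := (P.complex.linearYonedaObj R Y).sc n

variable (R) in
/-- The module of `n`-cocycles of a projective resolution with values in `Y`. -/
abbrev yonedaCocycles : Submodule R (P.complex.X n ⟶ Y) :=
  LinearMap.ker (Linear.leftComp R Y (P.complex.d ((ComplexShape.up ℕ).next n) n))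

variable (R) in
/-- The map from cocycles to Yoneda `Ext` groups. -/
def extOfCocycle [HasExt C] : yonedaCocycles R P Y n →ₗ[R] Abelian.Ext X Y n where
  toFun z := P.extMk z.1 ((ComplexShape.up ℕ).next n) (by simp) z.2
  map_add' z w := (P.add_extMk _ _ _ _ _ _).symm
  map_smul' r z := by
    refine Eq.trans ?_ (Abelian.Ext.smul_eq_comp_mk₀ _ _).symm
    refine Eq.trans ?_ (P.extMk_comp_mk₀ z.1 ((ComplexShape.up ℕ).next n) (by simp) z.2 _).symm
    have h : (r • z).1 = z.1 ≫ (r • 𝟙 Y) := by rw [Linear.comp_smul, Category.comp_id]; rfl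
    exact extMk_congr P h _ _ _

variable (R) in
/-- The map from cocycles to the derived functor `Ext`. -/
def derivedOfCocycle [EnoughProjectives C] :
    yonedaCocycles R P Y n →ₗ[R] ((_root_.Ext R C n).obj (op X)).obj Y :=
  (P.isoExt n Y).inv.hom ∘ₗ homologyClass (yonedaSc R P Y n)

theorem extOfCocycle_surjective [HasExt C] : Function.Surjective (extOfCocycle R P Y n) := by
  intro α
  obtain ⟨f, hf, h⟩ := P.extMk_surjective α ((ComplexShape.up ℕ).next n) (by simp)
  exact ⟨⟨f, hf⟩, h⟩

theorem derivedOfCocycle_surjective [EnoughProjectives C] :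
    Function.Surjective (derivedOfCocycle R P Y n) := by
  have : Function.Surjective (P.isoExt (R := R) n Y).inv.hom :=
    (ModuleCat.epi_iff_surjective _).mp inferInstance
  exact this.comp (homologyClass_surjective _)

theorem derivedOfCocycle_eq_zero_iff [EnoughProjectives C] (z : yonedaCocycles R P Y n) :
    derivedOfCocycle R P Y n z = 0 ↔
      ∃ g : P.complex.X ((ComplexShape.up ℕ).prev n) ⟶ Y,
        P.complex.d n ((ComplexShape.up ℕ).prev n) ≫ g = z.1 := by
  have hinj : Function.Injective (P.isoExt (R := R) n Y).inv.hom :=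
    (ModuleCat.mono_iff_injective _).mp inferInstance
  exact (map_eq_zero_iff _ hinj).trans (homologyClass_eq_zero_iff _ _)

theorem extOfCocycle_eq_zero_iff [HasExt C] (z : yonedaCocycles R P Y n) :
    extOfCocycle R P Y n z = 0 ↔
      ∃ g : P.complex.X ((ComplexShape.up ℕ).prev n) ⟶ Y,
        P.complex.d n ((ComplexShape.up ℕ).prev n) ≫ g = z.1 := by
  rcases n with _ | n
  · have hd : P.complex.d 0 ((ComplexShape.up ℕ).prev 0) = 0 := P.complex.shape _ _ (by simp)
    constructor
    · intro h
      have hz := extMk_zero_injective P z.1 ((ComplexShape.up ℕ).next 0) (by simp) z.2 h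
      exact ⟨0, by rw [Limits.comp_zero, hz]⟩
    · rintro ⟨g, hg⟩
      rw [hd, Limits.zero_comp] at hg
      rw [show z = 0 from Subtype.ext hg.symm, map_zero]
  · exact P.extMk_eq_zero_iff z.1 ((ComplexShape.up ℕ).next (n + 1)) (by simp) z.2 _ (by simp)

variable [EnoughProjectives C] [HasExt C]

/-- The isomorphism between the two `Ext` modules defined by a projective resolution. -/
def extEquiv : Abelian.Ext X Y n ≃ₗ[R] ((_root_.Ext R C n).obj (op X)).obj Y :=
  ((extOfCocycle R P Y n).quotKerEquivOfSurjective (extOfCocycle_surjective P Y n)).symm ≪≫ₗ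
    Submodule.quotEquivOfEq _ _ (by
      ext z
      rw [LinearMap.mem_ker, LinearMap.mem_ker, extOfCocycle_eq_zero_iff,
        derivedOfCocycle_eq_zero_iff]) ≪≫ₗ
    (derivedOfCocycle R P Y n).quotKerEquivOfSurjective (derivedOfCocycle_surjective P Y n)

theorem extEquiv_extOfCocycle (z : yonedaCocycles R P Y n) :
    extEquiv P Y n (extOfCocycle R P Y n z) = derivedOfCocycle R P Y n z := by
  have : ((extOfCocycle R P Y n).quotKerEquivOfSurjective
      (extOfCocycle_surjective P Y n)).symm (extOfCocycle R P Y n z) =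
      Submodule.Quotient.mk z := by
    rw [LinearEquiv.symm_apply_eq]
    rfl
  rw [extEquiv, LinearEquiv.trans_apply, LinearEquiv.trans_apply, this]
  rfl

/-- The comparison isomorphism is natural in the first variable. -/
theorem extEquiv_naturality {X' : C} (P' : ProjectiveResolution X') (g : X' ⟶ X)
    (α : Abelian.Ext X Y n) :
    extEquiv P' Y n ((Abelian.Ext.mk₀ g).comp α (zero_add n)) =
      (((_root_.Ext R C n).map g.op).app Y).hom (extEquiv P Y n α) := by
  obtain ⟨z, rfl⟩ := extOfCocycle_surjective (R := R) P Y n α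
  let φ : ProjectiveResolution.Hom P' P g :=
    ⟨ProjectiveResolution.lift g P' P, by
      simpa only [HomologicalComplex.comp_f, ChainComplex.single₀_map_f_zero] using
        congrArg (fun f => f.f 0) (ProjectiveResolution.lift_commutes g P' P)⟩
  have hcomm : P'.complex.d ((ComplexShape.up ℕ).next n) n ≫ φ.hom.f n ≫ z.1 = 0 := by
    rw [← Category.assoc, ← φ.hom.comm, Category.assoc]
    have : P.complex.d ((ComplexShape.up ℕ).next n) n ≫ z.1 = 0 := z.2
    rw [this, Limits.comp_zero]
  let z' : yonedaCocycles R P' Y n := ⟨φ.hom.f n ≫ z.1, hcomm⟩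
  have h1 : (Abelian.Ext.mk₀ g).comp (extOfCocycle R P Y n z) (zero_add n) =
      extOfCocycle R P' Y n z' :=
    ProjectiveResolution.mk₀_comp_extMk z.1 ((ComplexShape.up ℕ).next n) (by simp) z.2 φ
  rw [h1, extEquiv_extOfCocycle, extEquiv_extOfCocycle]
  have hinj : Function.Injective (P'.isoExt (R := R) n Y).hom.hom :=
    (ModuleCat.mono_iff_injective _).mp inferInstance
  apply hinj
  have h2 := congrArg (fun f => f.hom (derivedOfCocycle R P Y n z))
    (ext_map_comp_isoExt_hom (R := R) φ n Y)
  refine Eq.trans ?_ h2.symm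
  have h3 (X : C) (P : ProjectiveResolution X) (z : yonedaCocycles R P Y n) :
      (P.isoExt n Y).hom.hom (derivedOfCocycle R P Y n z) =
        homologyClass (yonedaSc R P Y n) z :=
    congrArg (fun f => f.hom (homologyClass (yonedaSc R P Y n) z)) (P.isoExt n Y).inv_hom_id
  change (P'.isoExt n Y).hom.hom (derivedOfCocycle R P' Y n z') =
    (HomologicalComplex.homologyMap (linearYonedaObjMap φ.hom Y) n).hom
      ((P.isoExt n Y).hom.hom (derivedOfCocycle R P Y n z))
  rw [h3, h3]
  exact (homologyMap_homologyClass ((HomologicalComplex.shortComplexFunctor _ _ n).map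
    (linearYonedaObjMap (R := R) φ.hom Y)) z z' rfl).symm

end Cocycles

end ExtComparison

/-! ### Yoneda `Ext` groups by dimension shifting -/

section DimensionShift

open CategoryTheory Abelian

universe v w

variable {C : Type*} [Category.{v} C] [Abelian C] [HasExt.{w} C]

/-- A resolution of `M 0` cut into short exact sequences `0 ⟶ M i ⟶ E (i + 1) ⟶ M (i + 1) ⟶ 0`
with injective middle terms. For uniformity there is also a zero map `E 0 ⟶ M 0`. -/
structure Cosyzygies (C : Type*) [Category.{v} C] [Abelian C] where
  /-- The injective objects. -/
  E : ℕ → C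
  /-- The cosyzygies. -/
  M : ℕ → C
  /-- The projections. -/
  p (i : ℕ) : E i ⟶ M i
  /-- The inclusions. -/
  j (i : ℕ) : M i ⟶ E (i + 1)
  p_zero : p 0 = 0
  zero (i : ℕ) : j i ≫ p (i + 1) = 0
  shortExact (i : ℕ) : (ShortComplex.mk (j i) (p (i + 1)) (zero i)).ShortExact
  injective (i : ℕ) : Injective (E (i + 1))

namespace Cosyzygies

attribute [instance] injective

variable (S : Cosyzygies C)

/-- The class in `Ext^i(M i, M 0)` of the exact sequence
`0 ⟶ M 0 ⟶ E 1 ⟶ ⋯ ⟶ E i ⟶ M i ⟶ 0`. -/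
def extClass : ∀ i : ℕ, Ext (S.M i) (S.M 0) i
  | 0 => Ext.mk₀ (𝟙 _)
  | i + 1 => (S.shortExact i).extClass.comp (extClass i) (add_comm 1 i)

theorem comp_extClass_succ {X : C} {i k m n : ℕ} (α : Ext X (S.M (i + 1)) k)
    (h : k + (i + 1) = n) (hm : k + 1 = m) (hn : m + i = n) :
    α.comp (S.extClass (i + 1)) h = (α.comp (S.shortExact i).extClass hm).comp (S.extClass i) hn :=
  (Ext.comp_assoc α (S.shortExact i).extClass (S.extClass i) hm (add_comm 1 i) (by lia)).symm

/-- Dimension shifting: the terms `E (i + 1)` have no higher `Ext` groups. -/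
theorem comp_extClass_bijective (X : C) (i : ℕ) {k n : ℕ} (h : (k + 1) + i = n) :
    Function.Bijective fun α : Ext X (S.M i) (k + 1) => α.comp (S.extClass i) h := by
  induction i generalizing k with
  | zero =>
    subst h
    convert Function.bijective_id with α
    exact Ext.comp_mk₀_id α
  | succ i ih =>
    have h1 (α : Ext X (S.M (i + 1)) (k + 1)) : α.comp (S.extClass (i + 1)) h =
        (α.comp (S.shortExact i).extClass rfl).comp (S.extClass i) (by lia) :=
      S.comp_extClass_succ α h rfl (by lia)
    simp only [h1]
    refine (ih (k := k + 1) (by lia)).comp ⟨?_, ?_⟩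
    · refine (injective_iff_map_eq_zero
        ((S.shortExact i).extClass.postcomp X (a := k + 1) rfl)).mpr fun α hα => ?_
      obtain ⟨β, rfl⟩ := Ext.covariant_sequence_exact₃ X (S.shortExact i) α rfl hα
      rw [Ext.eq_zero_of_injective β, Ext.zero_comp]
    · intro β
      exact Ext.covariant_sequence_exact₁ X (S.shortExact i) β (Ext.eq_zero_of_injective _) rfl

theorem exists_mk₀_comp_extClass (X : C) (i : ℕ) (β : Ext X (S.M 0) i) :
    ∃ φ : X ⟶ S.M i, (Ext.mk₀ φ).comp (S.extClass i) (zero_add i) = β := by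
  cases i with
  | zero =>
    obtain ⟨φ, rfl⟩ := Ext.addEquiv₀.symm.surjective β
    exact ⟨φ, Ext.comp_mk₀_id _⟩
  | succ i =>
    obtain ⟨γ, rfl⟩ := (S.comp_extClass_bijective X i (k := 0) (add_comm 1 i)).2 β
    obtain ⟨φ, rfl⟩ := Ext.covariant_sequence_exact₁ X (S.shortExact i) γ
      (Ext.eq_zero_of_injective _) rfl
    obtain ⟨φ, rfl⟩ := Ext.addEquiv₀.symm.surjective φ
    exact ⟨φ, S.comp_extClass_succ _ _ (zero_add 1) (add_comm 1 i)⟩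

theorem mk₀_comp_extClass_eq_zero_iff {X : C} {i : ℕ} (φ : X ⟶ S.M i) :
    (Ext.mk₀ φ).comp (S.extClass i) (zero_add i) = 0 ↔ ∃ ψ : X ⟶ S.E i, ψ ≫ S.p i = φ := by
  cases i with
  | zero =>
    have : (Ext.mk₀ φ).comp (S.extClass 0) (zero_add 0) = Ext.mk₀ φ := Ext.comp_mk₀_id _
    rw [this, Ext.mk₀_eq_zero_iff, S.p_zero]
    simp [eq_comm]
  | succ i =>
    have h1 : (Ext.mk₀ φ).comp (S.extClass (i + 1)) (zero_add (i + 1)) =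
        ((Ext.mk₀ φ).comp (S.shortExact i).extClass (zero_add 1)).comp (S.extClass i)
          (add_comm 1 i) :=
      S.comp_extClass_succ _ _ (zero_add 1) (add_comm 1 i)
    have h2 := (S.comp_extClass_bijective X i (k := 0) (add_comm 1 i)).1
    rw [h1]
    constructor
    · intro h
      have h3 := h2 (h.trans (Ext.zero_comp _ _ _ _ _).symm)
      obtain ⟨ψ, hψ⟩ := Ext.covariant_sequence_exact₃ X (S.shortExact i) (Ext.mk₀ φ) _ h3
      obtain ⟨ψ, rfl⟩ := Ext.addEquiv₀.symm.surjective ψ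
      refine ⟨ψ, Ext.addEquiv₀.symm.injective ?_⟩
      exact (Ext.mk₀_comp_mk₀ ψ (S.p (i + 1))).symm.trans hψ
    · rintro ⟨ψ, rfl⟩
      have h4 : (Ext.mk₀ (ψ ≫ S.p (i + 1))).comp (S.shortExact i).extClass (zero_add 1) = 0 := by
        rw [← Ext.mk₀_comp_mk₀, Ext.comp_assoc_of_second_deg_zero]
        have := (S.shortExact i).comp_extClass
        refine (congrArg (fun α => (Ext.mk₀ ψ).comp α (zero_add 1)) this).trans
          (Ext.comp_zero _ _ _ _ _)
      rw [h4, Ext.zero_comp]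

end Cosyzygies

end DimensionShift

/-! ### Local cohomology by injective resolutions -/

section DirectedUnion

variable {R : Type*} [CommRing R] {T H : Type*} [AddCommGroup T] [Module R T] [AddCommGroup H]
  [Module R H]

/-- A module exhausted by submodules `V n`, with compatible linear maps `V n → H` that are jointly
surjective and whose kernels have union `N`, has `H` as quotient by `N`. -/
theorem nonempty_quotient_linearEquiv_of_iUnion (V : ℕ → Submodule R T) (hV : Monotone V)
    (hT : ∀ t, ∃ n, t ∈ V n) (φ : ∀ n, V n →ₗ[R] H)
    (hφ : ∀ n m (h : n ≤ m) (t : V n), φ m ⟨t, hV h t.2⟩ = φ n t)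
    (hsurj : ∀ y, ∃ n t, φ n t = y) (N : Submodule R T)
    (hN : ∀ n (t : V n), φ n t = 0 ↔ (t : T) ∈ N) : Nonempty ((T ⧸ N) ≃ₗ[R] H) := by
  choose d hd using hT
  have hind {n : ℕ} {t : T} (h : t ∈ V n) : φ (d t) ⟨t, hd t⟩ = φ n ⟨t, h⟩ := by
    rw [← hφ n (max n (d t)) (le_max_left _ _), ← hφ (d t) (max n (d t)) (le_max_right _ _)]
  let Φ : T →ₗ[R] H :=
    { toFun t := φ (d t) ⟨t, hd t⟩
      map_add' s t := by
        have hs := hV (le_max_left (d s) (d t)) (hd s)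
        have ht := hV (le_max_right (d s) (d t)) (hd t)
        rw [hind hs, hind ht, hind (Submodule.add_mem _ hs ht), ← map_add]
        rfl
      map_smul' r t := by
        rw [hind (Submodule.smul_mem _ r (hd t)), RingHom.id_apply, ← map_smul]
        rfl }
  have hΦ : Function.Surjective Φ := fun y => by
    obtain ⟨n, t, rfl⟩ := hsurj y
    exact ⟨t, hind t.2⟩
  have hker : LinearMap.ker Φ = N := by
    ext t
    exact hN (d t) ⟨t, hd t⟩
  subst hker
  exact ⟨Φ.quotKerEquivOfSurjective hΦ⟩

end DirectedUnion

section LocalCohomology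

open CategoryTheory Abelian Opposite

variable {R : Type u} [CommRing R]

/-- The elements of a module annihilated by an ideal. -/
def annihilated (I : Ideal R) (M : Type*) [AddCommGroup M] [Module R M] : Submodule R M where
  carrier := {m | ∀ a ∈ I, a • m = 0}
  zero_mem' _ _ := smul_zero _
  add_mem' hx hy a ha := by rw [smul_add, hx a ha, hy a ha, add_zero]
  smul_mem' r x hx a ha := by rw [smul_comm, hx a ha, smul_zero]

theorem annihilated_anti {I J : Ideal R} (h : I ≤ J) (M : Type*) [AddCommGroup M] [Module R M] :
    annihilated J M ≤ annihilated I M := fun _ hm a ha => hm a (h ha)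

theorem hom_quotient_ext {I : Ideal R} {M : ModuleCat.{u} R} {φ ψ : ModuleCat.of R (R ⧸ I) ⟶ M}
    (h : φ.hom (I.mkQ 1) = ψ.hom (I.mkQ 1)) : φ = ψ :=
  ModuleCat.hom_ext (Submodule.linearMap_qext _ (LinearMap.ext_ring h))

/-- The map `R ⧸ I → M` defined by an element of `M` annihilated by `I`. -/
def annihilatedHom (I : Ideal R) (M : ModuleCat.{u} R) (m : annihilated I M) :
    ModuleCat.of R (R ⧸ I) ⟶ M :=
  ModuleCat.ofHom (I.liftQ (LinearMap.toSpanSingleton R M m) fun a ha => m.2 a ha)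

theorem annihilatedHom_mkQ_one (I : Ideal R) (M : ModuleCat.{u} R) (m : annihilated I M) :
    (annihilatedHom I M m).hom (I.mkQ 1) = m :=
  (I.liftQ_apply _ _).trans (one_smul R m.1)

/-- Maps `R ⧸ I → M` correspond to elements of `M` annihilated by `I`. -/
def ofAnnihilated (I : Ideal R) (M : ModuleCat.{u} R) :
    annihilated I M →ₗ[R] (ModuleCat.of R (R ⧸ I) ⟶ M) where
  toFun := annihilatedHom I M
  map_add' m m' := hom_quotient_ext <|
    (annihilatedHom_mkQ_one I M (m + m')).trans
      (congrArg₂ (· + ·) (annihilatedHom_mkQ_one I M m) (annihilatedHom_mkQ_one I M m')).symm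
  map_smul' r m := hom_quotient_ext <|
    (annihilatedHom_mkQ_one I M (r • m)).trans
      (congrArg (r • ·) (annihilatedHom_mkQ_one I M m)).symm

theorem map_mem_annihilated {I : Ideal R} {M : ModuleCat.{u} R} (φ : ModuleCat.of R (R ⧸ I) ⟶ M) :
    φ.hom (I.mkQ 1) ∈ annihilated I M := fun a ha => by
  rw [← map_smul, ← map_smul, smul_eq_mul, mul_one,
    show I.mkQ a = 0 from (Submodule.Quotient.mk_eq_zero I).mpr ha, map_zero]

theorem ofAnnihilated_surjective (I : Ideal R) (M : ModuleCat.{u} R) :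
    Function.Surjective (ofAnnihilated I M) := fun φ =>
  ⟨⟨_, map_mem_annihilated φ⟩, hom_quotient_ext (annihilatedHom_mkQ_one I M _)⟩

instance : Limits.PreservesFilteredColimitsOfSize.{0, 0} (forget (ModuleCat.{u} R)) :=
  Limits.preservesFilteredColimitsOfSize_shrink.{0, u, 0, u} _

variable (S : Cosyzygies (ModuleCat.{u} R)) (I : Ideal R) (i : ℕ)

/-- The functor `n ↦ Ext^i(R ⧸ I ^ n, M)` whose colimit is local cohomology. -/
abbrev extSystem (M : ModuleCat.{u} R) : ℕᵒᵖᵒᵖ ⥤ ModuleCat.{u} R :=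
  localCohomology.diagram (localCohomology.idealPowersDiagram I) i ⋙ (evaluation _ _).obj M

/-- Local cohomology as a cocone over `n ↦ Ext^i(R ⧸ I ^ n, M)`. -/
def extCocone (M : ModuleCat.{u} R) : Limits.Cocone (extSystem I i M) :=
  ((evaluation _ _).obj M).mapCocone
    (Limits.colimit.cocone (localCohomology.diagram (localCohomology.idealPowersDiagram I) i))

/-- The colimit defining local cohomology is computed pointwise. -/
def isColimitExtCocone (M : ModuleCat.{u} R) : Limits.IsColimit (extCocone I i M) :=
  Limits.isColimitOfPreserves _ (Limits.colimit.isColimit _)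

/-- The map from elements of `M i` annihilated by `I ^ n` to `Ext^i(R ⧸ I ^ n, M 0)`. -/
def toExtSystem (n : ℕ) :
    annihilated (I ^ n) (S.M i) →ₗ[R] (extSystem I i (S.M 0)).obj (op (op n)) :=
  (extEquiv (R := R) (projectiveResolution (ModuleCat.of R (R ⧸ I ^ n))) (S.M 0) i).toLinearMap ∘ₗ
    Ext.postcompOfLinear (S.extClass i) R _ (zero_add i) ∘ₗ
      (Ext.linearEquiv₀ (R := R)).symm.toLinearMap ∘ₗ ofAnnihilated (I ^ n) (S.M i)

theorem toExtSystem_eq_map {n m : ℕ} (h : n ≤ m) (t : annihilated (I ^ n) (S.M i)) :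
    toExtSystem S I i m ⟨t, annihilated_anti (Ideal.pow_le_pow_right h) _ t.2⟩ =
      ((extSystem I i (S.M 0)).map (homOfLE h).op.op).hom (toExtSystem S I i n t) := by
  let g : ModuleCat.of R (R ⧸ I ^ m) ⟶ ModuleCat.of R (R ⧸ I ^ n) :=
    (localCohomology.ringModIdeals (localCohomology.idealPowersDiagram I)).map
      (homOfLE h).op
  have h1 : (Ext.mk₀ g).comp ((Ext.mk₀ (annihilatedHom (I ^ n) (S.M i) t)).comp (S.extClass i)
      (zero_add i)) (zero_add i) = (Ext.mk₀ (annihilatedHom (I ^ m) (S.M i)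
        ⟨t, annihilated_anti (Ideal.pow_le_pow_right h) _ t.2⟩)).comp (S.extClass i)
          (zero_add i) := by
    rw [Ext.mk₀_comp_mk₀_assoc]
    congr 2
    refine hom_quotient_ext ?_
    refine (annihilatedHom_mkQ_one (I ^ n) (S.M i) t).trans ?_
    exact (annihilatedHom_mkQ_one (I ^ m) (S.M i) ⟨t, _⟩).symm
  refine (congrArg (extEquiv (R := R) (projectiveResolution (ModuleCat.of R (R ⧸ I ^ m)))
    (S.M 0) i) h1.symm).trans ?_
  exact extEquiv_naturality (projectiveResolution (ModuleCat.of R (R ⧸ I ^ n))) (S.M 0) i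
    (projectiveResolution (ModuleCat.of R (R ⧸ I ^ m))) g _

theorem toExtSystem_surjective (n : ℕ) : Function.Surjective (toExtSystem S I i n) := by
  intro y
  obtain ⟨α, rfl⟩ := (extEquiv (R := R) (projectiveResolution (ModuleCat.of R (R ⧸ I ^ n)))
    (S.M 0) i).surjective y
  obtain ⟨φ, rfl⟩ := S.exists_mk₀_comp_extClass _ i α
  obtain ⟨t, rfl⟩ := ofAnnihilated_surjective _ _ φ
  exact ⟨t, rfl⟩

theorem toExtSystem_eq_zero_iff {n : ℕ} (t : annihilated (I ^ n) (S.M i)) :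
    toExtSystem S I i n t = 0 ↔ ∃ e ∈ annihilated (I ^ n) (S.E i), (S.p i).hom e = t := by
  refine ((extEquiv (R := R) (projectiveResolution (ModuleCat.of R (R ⧸ I ^ n)))
    (S.M 0) i).map_eq_zero_iff).trans ((S.mk₀_comp_extClass_eq_zero_iff _).trans ?_)
  constructor
  · rintro ⟨ψ, hψ⟩
    refine ⟨_, map_mem_annihilated ψ, ?_⟩
    refine Eq.trans ?_ (annihilatedHom_mkQ_one (I ^ n) (S.M i) t)
    exact congrArg (fun f => f.hom ((I ^ n).mkQ 1)) hψ
  · rintro ⟨e, he, ht⟩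
    refine ⟨annihilatedHom (I ^ n) (S.E i) ⟨e, he⟩, hom_quotient_ext ?_⟩
    refine Eq.trans ?_ (annihilatedHom_mkQ_one (I ^ n) (S.M i) t).symm
    exact (congrArg (S.p i).hom (annihilatedHom_mkQ_one (I ^ n) (S.E i) ⟨e, he⟩)).trans ht

/-- The map from elements of `M i` annihilated by `I ^ n` to local cohomology. -/
def toLocalCohomology (n : ℕ) :
    annihilated (I ^ n) (S.M i) →ₗ[R] (localCohomology I i).obj (S.M 0) :=
  ((extCocone I i (S.M 0)).ι.app (op (op n))).hom ∘ₗ toExtSystem S I i n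

theorem toLocalCohomology_of_le {n m : ℕ} (h : n ≤ m) (t : annihilated (I ^ n) (S.M i)) :
    toLocalCohomology S I i m ⟨t, annihilated_anti (Ideal.pow_le_pow_right h) _ t.2⟩ =
      toLocalCohomology S I i n t := by
  have h1 := (extCocone I i (S.M 0)).w (homOfLE h).op.op
  have h2 := congrArg (fun f => f.hom (toExtSystem S I i n t)) h1
  refine Eq.trans ?_ h2
  exact congrArg ((extCocone I i (S.M 0)).ι.app (op (op m))).hom (toExtSystem_eq_map S I i h t)

theorem exists_toLocalCohomology_eq (y : (localCohomology I i).obj (S.M 0)) :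
    ∃ n t, toLocalCohomology S I i n t = y := by
  obtain ⟨n, z, hz⟩ := Limits.Concrete.isColimit_exists_rep (extSystem I i (S.M 0))
    (isColimitExtCocone I i (S.M 0)) y
  obtain ⟨t, rfl⟩ := toExtSystem_surjective S I i n.unop.unop z
  exact ⟨n.unop.unop, t, hz⟩

theorem toLocalCohomology_eq_zero_iff {n : ℕ} (t : annihilated (I ^ n) (S.M i)) :
    toLocalCohomology S I i n t = 0 ↔
      ∃ m, ∃ e ∈ annihilated (I ^ m) (S.E i), (S.p i).hom e = t := by
  constructor
  · intro h
    obtain ⟨k, f, g, hfg⟩ := Limits.Concrete.isColimit_exists_of_rep_eq (extSystem I i (S.M 0))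
      (isColimitExtCocone I i (S.M 0)) (toExtSystem S I i n t)
      (0 : (extSystem I i (S.M 0)).obj (op (op n))) (h.trans (map_zero _).symm)
    have hle : n ≤ k.unop.unop := leOfHom f.unop.unop
    have h1 : toExtSystem S I i k.unop.unop
        ⟨t, annihilated_anti (Ideal.pow_le_pow_right hle) _ t.2⟩ = 0 :=
      (toExtSystem_eq_map S I i hle t).trans (hfg.trans (map_zero _))
    exact ⟨k.unop.unop, (toExtSystem_eq_zero_iff S I i _).mp h1⟩
  · rintro ⟨m, e, he, ht⟩
    have hn := le_max_left n m
    have hm := le_max_right n m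
    rw [← toLocalCohomology_of_le S I i hn]
    have h1 := (toExtSystem_eq_zero_iff S I i
      ⟨t, annihilated_anti (Ideal.pow_le_pow_right hn) _ t.2⟩).mpr
      ⟨e, annihilated_anti (Ideal.pow_le_pow_right hm) _ he, ht⟩
    exact (congrArg ((extCocone I i (S.M 0)).ι.app (op (op (max n m)))).hom h1).trans (map_zero _)

end LocalCohomology

section Resolution

open CategoryTheory

variable {R ι : Type u} [CommRing R] {δ : ι → Derivation ℤ R R}

/-- The resolution of `R`-modules underlying a resolution over the operator ring. -/
def Cosyzygies.ofStages (F : ℕ → Stage δ) (hF : ∀ n, (F n).Next (F (n + 1)))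
    (h₀ : (F 0).π = 0) : Cosyzygies (ModuleCat.{u} R) where
  E n := ModuleCat.of R (F n).E
  M n := ModuleCat.of R (F n).M
  p n := ModuleCat.ofHom ((F n).π.restrictScalars R)
  j n := ModuleCat.ofHom ((hF n).choose.restrictScalars R)
  p_zero := by
    rw [h₀]
    rfl
  zero n := ModuleCat.hom_ext (LinearMap.ext fun m =>
    (hF n).choose_spec.2.1.apply_apply_eq_zero m)
  shortExact n :=
    { exact := (ShortComplex.ShortExact.moduleCat_exact_iff_function_exact _).mpr
        (hF n).choose_spec.2.1
      mono_f := (ModuleCat.mono_iff_injective _).mpr (hF n).choose_spec.1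
      epi_g := (ModuleCat.epi_iff_surjective _).mpr (hF n).choose_spec.2.2 }
  injective n := Module.injective_object_of_injective_module R (F (n + 1)).E

/-- Local cohomology is computed by any resolution over the operator ring whose terms are injective
over `R`: it is `Γ_I` of the cosyzygy modulo the image of `Γ_I` of the injective module. -/
theorem Stage.nonempty_torsionQuotient_linearEquiv (F : ℕ → Stage δ)
    (hF : ∀ n, (F n).Next (F (n + 1))) (h₀ : (F 0).π = 0) (I : Ideal R) (i : ℕ) :
    Nonempty (TorsionQuotient I (F i).π ≃ₗ[R]
      (localCohomology I i).obj (ModuleCat.of R (F 0).M)) := by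
  let S := Cosyzygies.ofStages F hF h₀
  let τ : torsion δ I (F i).M →ₗ[R] (F i).M := (torsion δ I (F i).M).subtype.restrictScalars R
  let V (n : ℕ) : Submodule R (torsion δ I (F i).M) := (annihilated (I ^ n) (F i).M).comap τ
  have hV : Monotone V := fun n m h =>
    Submodule.comap_mono (annihilated_anti (Ideal.pow_le_pow_right h) _)
  let φ (n : ℕ) : V n →ₗ[R] (localCohomology I i).obj (ModuleCat.of R (F 0).M) :=
    toLocalCohomology S I i n ∘ₗ (τ ∘ₗ (V n).subtype).codRestrict (annihilated (I ^ n) (F i).M)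
      fun t => t.2
  obtain ⟨e⟩ := nonempty_quotient_linearEquiv_of_iUnion V hV (fun t => t.2) φ
    (fun n m h t => toLocalCohomology_of_le S I i h ⟨t.1.1, t.2⟩)
    (fun y => by
      obtain ⟨n, t, rfl⟩ := exists_toLocalCohomology_eq S I i y
      exact ⟨n, ⟨⟨t.1, n, t.2⟩, t.2⟩, rfl⟩)
    ((LinearMap.range (torsionMap I (F i).π)).restrictScalars R) (fun n t => by
      refine (toLocalCohomology_eq_zero_iff S I i _).trans ⟨?_, ?_⟩
      · rintro ⟨m, e, he, h⟩
        exact ⟨⟨e, m, he⟩, Subtype.ext h⟩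
      · rintro ⟨⟨e, m, he⟩, h⟩
        exact ⟨m, e, he, congrArg Subtype.val h⟩)
  exact ⟨(Submodule.Quotient.restrictScalarsEquiv R _).symm ≪≫ₗ e⟩

end Resolution

/-! ### Finiteness of the module of derivations -/

section Derivation

variable {K R : Type*} [CommRing K] [CommRing R] [Algebra K R]

/-- If `R` is finite over `K` modulo a proper ideal `n`, then a `K`-derivation is determined by its
values on finitely many elements: a derivation that vanishes on generators of `R` modulo `n` and on
generators of `n` maps `R` into all powers of `n`. -/
theorem finite_derivation_of_finite_modulo [IsDomain R] [IsNoetherianRing R] {n : Ideal R}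
    (hn : n ≠ ⊤) (s : Finset R) (hs : ⊤ ≤ Submodule.span K (s : Set R) ⊔ n.restrictScalars K) :
    Module.Finite R (Derivation K R R) := by
  classical
  obtain ⟨t, ht⟩ : n.FG := IsNoetherian.noetherian n
  let ev : Derivation K R R →ₗ[R] (↥(s ∪ t) → R) :=
    { toFun d x := d x
      map_add' _ _ := rfl
      map_smul' _ _ := rfl }
  refine Module.Finite.of_injective ev ((injective_iff_map_eq_zero ev).mpr fun d hd => ?_)
  have hd' (x : R) (hx : x ∈ s ∪ t) : d x = 0 := congrFun hd ⟨x, hx⟩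
  have hspan (x : R) (hx : x ∈ Submodule.span K (s : Set R)) : d x = 0 := by
    induction hx using Submodule.span_induction with
    | mem x hx => exact hd' x (Finset.mem_union_left _ hx)
    | zero => exact map_zero d
    | add x y _ _ hx hy => rw [map_add, hx, hy, add_zero]
    | smul c x _ hx => rw [Derivation.map_smul, hx, smul_zero]
  have hpow (N : ℕ) : ∀ x, d x ∈ n ^ N := by
    induction N with
    | zero => simp
    | succ N ih =>
      have hmem (x : R) (hx : x ∈ Submodule.span R (t : Set R)) : d x ∈ n ^ (N + 1) := by
        induction hx using Submodule.span_induction with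
        | mem x hx => simp [hd' x (Finset.mem_union_right _ hx)]
        | zero => simp
        | add x y _ _ hx hy => rw [map_add]; exact add_mem hx hy
        | smul c x hx' hx =>
          rw [smul_eq_mul, Derivation.leibniz, smul_eq_mul, smul_eq_mul, pow_succ']
          refine add_mem ?_ (Ideal.mul_mem_mul (ht ▸ hx') (ih c))
          rw [← pow_succ']
          exact Ideal.mul_mem_left _ _ hx
      intro x
      obtain ⟨y, hy, z, hz, rfl⟩ := Submodule.mem_sup.mp (hs (Submodule.mem_top (x := x)))
      rw [map_add, hspan y hy, zero_add]
      exact hmem z (ht.ge hz)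
  ext x
  have : d x ∈ ⨅ N, n ^ N := Ideal.mem_iInf.mpr fun N => hpow N x
  rwa [Ideal.iInf_pow_eq_bot_of_isDomain n hn] at this

end Derivation

section Approximation

/-- A ring whose elements are congruent modulo `m` to scalars is spanned modulo each power of `m`
by finitely many elements. -/
theorem exists_finset_span_sup_pow {S B : Type*} [CommRing S] [CommRing B] [Algebra S B]
    [IsNoetherianRing B] (m : Ideal B) (h : ∀ b : B, ∃ s : S, b - algebraMap S B s ∈ m) (n : ℕ) :
    ∃ t : Finset B, ⊤ ≤ Submodule.span S (t : Set B) ⊔ (m ^ n).restrictScalars S := by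
  classical
  induction n with
  | zero => exact ⟨∅, fun x _ => Submodule.mem_sup_right (by simp)⟩
  | succ n ih =>
    obtain ⟨t, ht⟩ := ih
    obtain ⟨g, hg⟩ : (m ^ n).FG := IsNoetherian.noetherian _
    have key (x : B) (hx : x ∈ Submodule.span B (g : Set B)) :
        x ∈ Submodule.span S (g : Set B) ⊔ (m ^ (n + 1)).restrictScalars S := by
      induction hx using Submodule.span_induction with
      | mem x hx => exact Submodule.mem_sup_left (Submodule.subset_span hx)
      | zero => exact zero_mem _
      | add x y _ _ hx hy => exact add_mem hx hy
      | smul b x hx' hx =>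
        obtain ⟨s, hs⟩ := h b
        have : b • x = s • x + (b - algebraMap S B s) * x := by
          rw [Algebra.smul_def s x, smul_eq_mul]
          ring
        rw [this]
        refine add_mem (Submodule.smul_mem _ s hx) (Submodule.mem_sup_right ?_)
        rw [Submodule.restrictScalars_mem, pow_succ']
        exact Ideal.mul_mem_mul hs (hg ▸ hx')
    refine ⟨t ∪ g, ht.trans (sup_le ?_ fun x hx => ?_)⟩
    · exact le_sup_of_le_left (Submodule.span_mono (by simp))
    · refine (sup_le_sup_right (Submodule.span_mono (by simp)) _ :
        Submodule.span S (g : Set B) ⊔ (m ^ (n + 1)).restrictScalars S ≤ _) (key x ?_)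
      exact hg.ge hx

/-- Finite free modules over a power series ring over a field are complete. -/
instance isPrecomplete_powerSeries (k ι : Type*) [Field k] :
    IsPrecomplete (Ideal.span {(PowerSeries.X : PowerSeries k)}) (ι → PowerSeries k) where
  prec' {F} hF := by
    have hmem (n : ℕ) (x : ι → PowerSeries k) :
        x ∈ (Ideal.span {(PowerSeries.X : PowerSeries k)} ^ n • ⊤ :
          Submodule (PowerSeries k) (ι → PowerSeries k)) ↔
        ∀ i, ∀ d < n, PowerSeries.coeff d (x i) = 0 := by
      rw [Ideal.span_singleton_pow, Submodule.ideal_span_singleton_smul]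
      simp only [← PowerSeries.X_pow_dvd_iff]
      rw [Submodule.mem_smul_pointwise_iff_exists]
      constructor
      · rintro ⟨y, -, rfl⟩ i
        exact ⟨y i, rfl⟩
      · intro h
        choose y hy using h
        exact ⟨y, trivial, funext fun i => (hy i).symm⟩
    refine ⟨fun i => PowerSeries.mk fun d => PowerSeries.coeff d (F (d + 1) i), fun n => ?_⟩
    rw [SModEq.sub_mem, hmem]
    intro i d hd
    have := hF (Nat.succ_le_of_lt hd)
    rw [SModEq.sub_mem, hmem] at this
    have h1 := this i d (Nat.lt_succ_self d)
    rw [Pi.sub_apply, map_sub, sub_eq_zero] at h1 ⊢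
    rw [PowerSeries.coeff_mk, ← h1]

/-- A form of Nakayama's lemma: a separated module over `k⟦X⟧` is spanned by finitely many elements
if it is spanned by them modulo `X`. -/
theorem span_eq_top_of_powerSeries {k M : Type*} [Field k] [AddCommGroup M]
    [Module (PowerSeries k) M] [IsHausdorff (Ideal.span {(PowerSeries.X : PowerSeries k)}) M]
    (s : Finset M) (hs : ⊤ ≤ Submodule.span (PowerSeries k) (s : Set M) ⊔
      (Ideal.span {(PowerSeries.X : PowerSeries k)} • ⊤ : Submodule (PowerSeries k) M)) :
    Submodule.span (PowerSeries k) (s : Set M) = ⊤ := by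
  let φ := Fintype.linearCombination (PowerSeries k) (Subtype.val : s → M)
  have hφ : LinearMap.range φ = Submodule.span (PowerSeries k) (s : Set M) := by
    rw [Fintype.range_linearCombination, Subtype.range_coe]
  rw [← hφ, LinearMap.range_eq_top]
  refine surjective_of_mkQ_comp_surjective
    (I := Ideal.span {(PowerSeries.X : PowerSeries k)}) fun y => ?_
  obtain ⟨y, rfl⟩ := Submodule.mkQ_surjective _ y
  obtain ⟨a, ha, b, hb, rfl⟩ := Submodule.mem_sup.mp (hs (Submodule.mem_top (x := y)))
  rw [← hφ] at ha
  obtain ⟨c, rfl⟩ := ha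
  refine ⟨c, ?_⟩
  rw [LinearMap.comp_apply, map_add, Submodule.mkQ_apply _ b,
    (Submodule.Quotient.mk_eq_zero _).mpr hb, add_zero]

end Approximation

section PrimeAvoidance

/-- If all nonzero primes of a Noetherian local domain contain `b ≠ 0`, then the maximal ideal is
the radical of `(b)`. -/
theorem le_radical_span_singleton {B : Type*} [CommRing B] [IsDomain B] [IsNoetherianRing B]
    [IsLocalRing B] {b : B} (hb : b ≠ 0)
    (h : ∀ p : Ideal B, p.IsPrime → p ≠ ⊥ → b ∈ p) :
    maximalIdeal B ≤ (Ideal.span {b}).radical := by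
  classical
  by_cases hm : maximalIdeal B = ⊥
  · rw [hm]
    exact bot_le
  have hbm := h _ (maximalIdeal.isMaximal B).isPrime hm
  let s := (Ideal.finite_minimalPrimes_of_isNoetherianRing B (Ideal.span {b})).toFinset
  have hs {p : Ideal B} : p ∈ s ↔ p ∈ (Ideal.span {b}).minimalPrimes := Set.Finite.mem_toFinset _
  have hmin {P : Ideal B} [P.IsPrime] (hP : b ∈ P) : ∃ p ∈ s, p ≤ P := by
    obtain ⟨p, hp, hpP⟩ := Ideal.exists_minimalPrimes_le
      ((Ideal.span_singleton_le_iff_mem P).mpr hP)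
    exact ⟨p, hs.mpr hp, hpP⟩
  have hcover : (maximalIdeal B : Set B) ⊆ ⋃ p ∈ (s : Set (Ideal B)), (p : Set B) := by
    intro x hx
    by_cases hx0 : x = 0
    · obtain ⟨p, hp, -⟩ := hmin hbm
      exact Set.mem_biUnion hp (hx0 ▸ p.zero_mem)
    · -- a minimal prime `P` over `x` has height one and contains `b`, so it is minimal over `b`
      obtain ⟨P, hP, -⟩ := Ideal.exists_minimalPrimes_le
        ((Ideal.span_singleton_le_iff_mem (maximalIdeal B)).mpr hx)
      have hPprime : P.IsPrime := hP.1.1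
      have hxP : x ∈ P := hP.1.2 (Ideal.mem_span_singleton_self x)
      have hbP : b ∈ P := h P hPprime fun h0 => hx0 (by simpa [h0] using hxP)
      obtain ⟨p, hp, hpP⟩ := hmin hbP
      have hpprime : p.IsPrime := (hs.mp hp).1.1
      have hbp : b ∈ p := (hs.mp hp).1.2 (Ideal.mem_span_singleton_self b)
      have hpht : 1 ≤ p.height :=
        (Ideal.one_le_height_span_singleton_of_mem_nonZeroDivisors
          (mem_nonZeroDivisors_of_ne_zero hb)).trans
          (Ideal.height_mono ((Ideal.span_singleton_le_iff_mem p).mpr hbp))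
      have heq : p = P := p.eq_of_le_of_height_le hpP
        ((Ideal.height_le_one_of_isPrincipal_of_mem_minimalPrimes _ P hP).trans hpht)
      exact Set.mem_biUnion hp (heq ▸ hxP)
  obtain ⟨p, hp, hmp⟩ := (Ideal.subset_union_prime ⊥ ⊥ fun p hp _ _ => (hs.mp hp).1.1).mp hcover
  rw [Ideal.radical_eq_sInf]
  refine le_sInf fun J hJ => hmp.trans ?_
  have hJm : J ≤ p := (IsLocalRing.le_maximalIdeal hJ.2.ne_top).trans hmp
  exact (hs.mp hp).2 ⟨hJ.2, hJ.1⟩ hJm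

end PrimeAvoidance

section LaurentSubfield

variable {k A : Type*} [Field k] [CommRing A] (σ : k →+* A) {f : A} {I : Ideal A}
  [IsAdicComplete I A] (hf : f ∈ I)

theorem laurentMap_coe (g : PowerSeries k) :
    laurentMap I σ f hf (algebraMap (PowerSeries k) (LaurentSeries k) g) =
      algebraMap A (Localization.Away f) (powerSeriesMap I σ f hf g) :=
  IsLocalization.lift_eq _ g

/-- The ring `A_f` is spanned over `k((f))` modulo a maximal ideal by finitely many elements. -/
theorem exists_finset_span_laurentSubfield [IsDomain A] [IsNoetherianRing A] [IsLocalRing A]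
    (hI : I = maximalIdeal A) (hσ : ∀ a, ∃ c, a - σ c ∈ maximalIdeal A)
    (n : Ideal (Localization.Away f)) [hn : n.IsMaximal] :
    ∃ s : Finset (Localization.Away f),
      ⊤ ≤ Submodule.span (laurentSubfield I σ f hf) (s : Set (Localization.Away f)) ⊔
        n.restrictScalars (laurentSubfield I σ f hf) := by
  classical
  subst hI
  let q : Ideal A := n.comap (algebraMap A _)
  have hfq : f ∉ q := fun h => Ideal.IsPrime.ne_top' (I := n)
    (Ideal.eq_top_of_isUnit_mem n h (IsLocalization.Away.algebraMap_isUnit f))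
  -- by maximality of `n`, every prime of `A` properly containing `q` contains `f`
  have hprime (p : Ideal A) (hp : p.IsPrime) (hqp : q < p) : f ∈ p := by
    by_contra hfp
    have hdisj : Disjoint (Submonoid.powers f : Set A) p := by
      rw [Ideal.disjoint_powers_iff_notMem f hp.isRadical]
      exact hfp
    have h1 := IsLocalization.isPrime_of_isPrime_disjoint (Submonoid.powers f)
      (Localization.Away f) p hp hdisj
    have h2 := IsLocalization.under_map_of_isPrime_disjoint (Submonoid.powers f)
      (Localization.Away f) hp hdisj
    have h3 : n ≤ p.map (algebraMap A (Localization.Away f)) := by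
      rw [← IsLocalization.map_under (Submonoid.powers f) (Localization.Away f) n]
      exact Ideal.map_mono hqp.le
    have h4 := hn.eq_of_le h1.ne_top h3
    refine hqp.ne ?_
    rw [← h2, ← h4]
  let B := A ⧸ q
  have : IsDomain B := Ideal.Quotient.isDomain q
  have : IsLocalRing B := IsLocalRing.of_surjective' (Ideal.Quotient.mk q)
    Ideal.Quotient.mk_surjective
  have hmk {a : A} (ha : a ∈ maximalIdeal A) : Ideal.Quotient.mk q a ∈ maximalIdeal B := by
    have : IsLocalHom (Ideal.Quotient.mk q) :=
      IsLocalHom.of_surjective _ Ideal.Quotient.mk_surjective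
    exact ((IsLocalRing.local_hom_TFAE (Ideal.Quotient.mk q)).out 0 3 rfl rfl).mp this ha
  let b : B := Ideal.Quotient.mk q f
  have hb : b ≠ 0 := fun h => hfq (Ideal.Quotient.eq_zero_iff_mem.mp h)
  have hrad : maximalIdeal B ≤ (Ideal.span {b}).radical := by
    refine le_radical_span_singleton hb fun p hp hp0 => ?_
    refine hprime (p.comap (Ideal.Quotient.mk q)) inferInstance (lt_of_le_of_ne ?_ fun h => hp0 ?_)
    · intro a ha
      rw [Ideal.mem_comap, Ideal.Quotient.eq_zero_iff_mem.mpr ha]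
      exact zero_mem p
    · rw [← Ideal.map_comap_of_surjective _ Ideal.Quotient.mk_surjective p, ← h]
      exact Ideal.map_quotient_self q
  obtain ⟨N, hN⟩ := Ideal.exists_pow_le_of_le_radical_of_fg hrad (IsNoetherian.noetherian _)
  let P := powerSeriesMap (maximalIdeal A) σ f hf
  let : Algebra (PowerSeries k) A := P.toAlgebra
  have hB (x : B) : ∃ g : PowerSeries k, x - algebraMap _ B g ∈ maximalIdeal B := by
    obtain ⟨a, rfl⟩ := Ideal.Quotient.mk_surjective x
    obtain ⟨c, hc⟩ := hσ a
    refine ⟨PowerSeries.C c, ?_⟩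
    have h1 : algebraMap (PowerSeries k) B (PowerSeries.C c) = Ideal.Quotient.mk q (σ c) :=
      congrArg (Ideal.Quotient.mk q) (powerSeriesMap_C (maximalIdeal A) σ f hf c)
    rw [h1, ← map_sub]
    exact hmk hc
  obtain ⟨t, ht⟩ := exists_finset_span_sup_pow (S := PowerSeries k) (maximalIdeal B) hB N
  have hX : algebraMap (PowerSeries k) B PowerSeries.X = b :=
    congrArg (Ideal.Quotient.mk q) (powerSeriesMap_X (maximalIdeal A) σ f hf)
  have hXmap : (Ideal.span {(PowerSeries.X : PowerSeries k)}).map (algebraMap _ B) =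
      Ideal.span {b} := by
    rw [Ideal.map_span, Set.image_singleton, hX]
  have hbm : b ∈ maximalIdeal B := hmk hf
  have hhaus : IsHausdorff (Ideal.span {(PowerSeries.X : PowerSeries k)}) B := by
    refine (IsHausdorff.map_algebraMap_iff (S := B) (M := B)).mp ?_
    rw [hXmap]
    refine IsHausdorff.of_isDomain _ (ne_top_of_le_ne_top (maximalIdeal.isMaximal B).ne_top ?_)
    exact (Ideal.span_singleton_le_iff_mem _).mpr hbm
  have hspan := span_eq_top_of_powerSeries t (ht.trans (sup_le_sup_left (by
    rw [Ideal.smul_top_eq_map, hXmap]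
    exact hN) _))
  let s := t.image (Function.surjInv (Ideal.Quotient.mk_surjective (I := q)))
  let mkq : A →ₗ[PowerSeries k] B := (Ideal.Quotient.mkₐ (PowerSeries k) q).toLinearMap
  have hst : mkq '' (s : Set A) = t := by
    rw [Finset.coe_image, Set.image_image]
    exact (Set.image_congr fun x _ =>
      Function.surjInv_eq (Ideal.Quotient.mk_surjective (I := q)) x).trans (Set.image_id _)
  refine ⟨s.image (algebraMap A _), fun x _ => ?_⟩
  have hA (y : A) (hy : y ∈ Submodule.span (PowerSeries k) (s : Set A)) :
      algebraMap A (Localization.Away f) y ∈ Submodule.span (laurentSubfield (maximalIdeal A) σ f hf)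
        (s.image (algebraMap A (Localization.Away f)) : Set (Localization.Away f)) := by
    induction hy using Submodule.span_induction with
    | mem y hy => exact Submodule.subset_span (Finset.mem_coe.mpr (Finset.mem_image_of_mem _ hy))
    | zero => simp
    | add y z _ _ hy hz =>
      rw [map_add]
      exact add_mem hy hz
    | smul g y _ hy =>
      have h1 : algebraMap A (Localization.Away f) (g • y) =
          (⟨laurentMap (maximalIdeal A) σ f hf (algebraMap _ _ g), _, rfl⟩ :
            laurentSubfield (maximalIdeal A) σ f hf) • algebraMap A (Localization.Away f) y := by
        rw [Algebra.smul_def, map_mul]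
        exact congrArg (· * _) (laurentMap_coe σ hf g).symm
      rw [h1]
      exact Submodule.smul_mem _ _ hy
  have hA' (a : A) : algebraMap A (Localization.Away f) a ∈
      Submodule.span (laurentSubfield (maximalIdeal A) σ f hf)
        (s.image (algebraMap A (Localization.Away f)) : Set (Localization.Away f)) ⊔
      n.restrictScalars (laurentSubfield (maximalIdeal A) σ f hf) := by
    have h1 : mkq a ∈ (Submodule.span (PowerSeries k) (s : Set A)).map mkq := by
      rw [Submodule.map_span, hst, hspan]
      trivial
    obtain ⟨y, hy, hya⟩ := h1
    have h2 : a - y ∈ q := Ideal.Quotient.eq.mp hya.symm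
    rw [← sub_add_cancel a y, map_add]
    exact add_mem (Submodule.mem_sup_right h2) (Submodule.mem_sup_left (hA y hy))
  obtain ⟨e, a, ha⟩ := IsLocalization.Away.surj f x
  let X : LaurentSeries k := algebraMap (PowerSeries k) _ PowerSeries.X
  have hX0 : X ≠ 0 := fun h => PowerSeries.X_ne_zero
    ((map_eq_zero_iff _ (IsFractionRing.injective (PowerSeries k) (LaurentSeries k))).mp h)
  have hXf : laurentMap (maximalIdeal A) σ f hf X = algebraMap A (Localization.Away f) f := by
    rw [laurentMap_coe, powerSeriesMap_X]
  have hxa : x = (⟨laurentMap (maximalIdeal A) σ f hf (X⁻¹ ^ e), _, rfl⟩ :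
      laurentSubfield (maximalIdeal A) σ f hf) • algebraMap A (Localization.Away f) a := by
    rw [← ha, ← hXf]
    change x = laurentMap (maximalIdeal A) σ f hf (X⁻¹ ^ e) *
      (x * laurentMap (maximalIdeal A) σ f hf X ^ e)
    rw [mul_left_comm, ← map_pow, ← map_mul, ← mul_pow, inv_mul_cancel₀ hX0, one_pow, map_one,
      mul_one]
  rw [hxa]
  exact Submodule.smul_mem _ _ (hA' a)

/-- The module of derivations of `A_f` over `k((f))` is finitely generated. -/
theorem finite_derivation_laurentSubfield [IsDomain A] [IsNoetherianRing A] [IsLocalRing A]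
    (hI : I = maximalIdeal A) (hσ : ∀ a, ∃ c, a - σ c ∈ maximalIdeal A) (hf0 : f ≠ 0) :
    Module.Finite (Localization.Away f)
      (Derivation (laurentSubfield I σ f hf) (Localization.Away f) (Localization.Away f)) := by
  have hle : Submonoid.powers f ≤ nonZeroDivisors A :=
    powers_le_nonZeroDivisors_of_noZeroDivisors hf0
  have : IsDomain (Localization.Away f) := IsLocalization.isDomain_localization hle
  have : IsNoetherianRing (Localization.Away f) :=
    IsLocalization.isNoetherianRing (Submonoid.powers f) _ inferInstance
  obtain ⟨n, hn⟩ := Ideal.exists_maximal (Localization.Away f)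
  obtain ⟨s, hs⟩ := exists_finset_span_laurentSubfield σ hf hI hσ n
  exact finite_derivation_of_finite_modulo hn.ne_top s hs

end LaurentSubfield

/-! ### Almost commutative rings are Noetherian -/

section AlmostCommutative

variable {R D ι : Type*} [CommRing R] [Ring D] [Module R D] (x : ι → D)

variable (R) in
/-- The span of the words of length less than `n`. -/
def wordSpan (n : ℕ) : Submodule R D :=
  Submodule.span R {d | ∃ l : List ι, l.length < n ∧ (l.map x).prod = d}

theorem wordSpan_mono {n m : ℕ} (h : n ≤ m) : wordSpan R x n ≤ wordSpan R x m :=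
  Submodule.span_mono fun _ ⟨l, hl, hd⟩ => ⟨l, hl.trans_le h, hd⟩

variable {x} in
theorem prod_mem_wordSpan {l : List ι} {n : ℕ} (h : l.length < n) :
    (l.map x).prod ∈ wordSpan R x n :=
  Submodule.subset_span ⟨l, h, rfl⟩

/-- Multiplication by the scalars and the elements `x i` commutes up to operators of lower
order. -/
structure AlmostCommutes (R : Type*) {D ι : Type*} [CommRing R] [Ring D] [Module R D]
    (x : ι → D) : Prop where
  mul_smul_one (i : ι) (r : R) : ∃ s : R, x i * (r • 1) = r • x i + s • 1
  commutator_mem (i j : ι) : x i * x j - x j * x i ∈ Submodule.span R (Set.range x)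

namespace AlmostCommutes

variable {x}

variable (R x) in
/-- The linear map sending a monomial to a word with the same letters. -/
def ofSymbol : MvPolynomial ι R →ₗ[R] D :=
  (MvPolynomial.basisMonomials ι R).constr R fun α => (α.toMultiset.toList.map x).prod

theorem ofSymbol_monomial (α : ι →₀ ℕ) (r : R) :
    ofSymbol R x (MvPolynomial.monomial α r) = r • (α.toMultiset.toList.map x).prod := by
  rw [show MvPolynomial.monomial α r = r • MvPolynomial.basisMonomials ι R α by
    simp [MvPolynomial.smul_monomial], map_smul, ofSymbol, Module.Basis.constr_basis]

variable [IsScalarTower R D D]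

theorem mul_smul (hx : AlmostCommutes R x) (i : ι) (r : R) :
    ∃ s : R, ∀ d : D, x i * (r • d) = r • (x i * d) + s • d := by
  obtain ⟨s, hs⟩ := hx.mul_smul_one i r
  refine ⟨s, fun d => ?_⟩
  rw [← one_mul d, ← smul_mul_assoc, ← mul_assoc, hs, add_mul, smul_mul_assoc, smul_mul_assoc,
    one_mul]

theorem mul_mem_wordSpan (hx : AlmostCommutes R x) (i : ι) {n : ℕ} {d : D}
    (hd : d ∈ wordSpan R x n) :
    x i * d ∈ wordSpan R x (n + 1) := by
  induction hd using Submodule.span_induction with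
  | mem d hd =>
    obtain ⟨l, hl, rfl⟩ := hd
    exact prod_mem_wordSpan (l := i :: l) (Nat.succ_lt_succ hl)
  | zero => simp
  | add d e _ _ hd he => rw [mul_add]; exact add_mem hd he
  | smul r d hd' hd =>
    obtain ⟨s, hs⟩ := hx.mul_smul i r
    rw [hs]
    exact add_mem (Submodule.smul_mem _ _ hd)
      (Submodule.smul_mem _ _ (wordSpan_mono x n.le_succ hd'))

theorem mul_mem_wordSpan_of_mem_span (hx : AlmostCommutes R x) {v : D}
    (hv : v ∈ Submodule.span R (Set.range x)) {n : ℕ}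
    {d : D} (hd : d ∈ wordSpan R x n) : v * d ∈ wordSpan R x (n + 1) := by
  induction hv using Submodule.span_induction with
  | mem v hv =>
    obtain ⟨i, rfl⟩ := hv
    exact hx.mul_mem_wordSpan i hd
  | zero => simp
  | add v w _ _ hv hw => rw [add_mul]; exact add_mem hv hw
  | smul r v _ hv => rw [smul_mul_assoc]; exact Submodule.smul_mem _ _ hv

/-- Permuting the letters of a word changes it by a combination of shorter words. -/
theorem prod_sub_prod_mem (hx : AlmostCommutes R x) {l l' : List ι} (h : l.Perm l') :
    (l.map x).prod - (l'.map x).prod ∈ wordSpan R x l.length := by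
  induction h with
  | nil => simp
  | cons i _ ih => simpa [mul_sub] using hx.mul_mem_wordSpan i ih
  | swap i j l =>
    have := hx.mul_mem_wordSpan_of_mem_span (hx.commutator_mem j i)
      (prod_mem_wordSpan (R := R) (x := x) (Nat.lt_succ_self l.length))
    simpa [sub_mul, mul_assoc] using this
  | trans h _ ih ih' =>
    rw [← sub_add_sub_cancel]
    exact add_mem ih (h.length_eq ▸ ih')

theorem exists_mem_wordSpan (hx : AlmostCommutes R x)
    (hgen : Subring.closure (Set.range (fun r : R => r • (1 : D)) ∪ Set.range x) = ⊤) (d : D) :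
    ∃ n, d ∈ wordSpan R x n := by
  suffices H : ∀ e n, e ∈ wordSpan R x n → ∃ m, d * e ∈ wordSpan R x m by
    simpa using H 1 1 (prod_mem_wordSpan (l := []) Nat.one_pos)
  have hd : d ∈ Subring.closure (Set.range (fun r : R => r • (1 : D)) ∪ Set.range x) :=
    hgen ▸ Subring.mem_top d
  induction hd using Subring.closure_induction with
  | mem d hd =>
    intro e n he
    obtain ⟨r, rfl⟩ | ⟨i, rfl⟩ := hd
    · exact ⟨n, by simpa using Submodule.smul_mem _ r he⟩
    · exact ⟨n + 1, hx.mul_mem_wordSpan i he⟩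
  | zero => exact fun e n _ => ⟨n, by simp⟩
  | one => exact fun e n he => ⟨n, by simpa using he⟩
  | add a b _ _ ha hb =>
    intro e n he
    obtain ⟨m, hm⟩ := ha e n he
    obtain ⟨m', hm'⟩ := hb e n he
    refine ⟨max m m', ?_⟩
    rw [add_mul]
    exact add_mem (wordSpan_mono x (le_max_left _ _) hm) (wordSpan_mono x (le_max_right _ _) hm')
  | neg a _ ha =>
    intro e n he
    obtain ⟨m, hm⟩ := ha e n he
    exact ⟨m, by simpa using hm⟩
  | mul a b _ _ ha hb =>
    intro e n he
    obtain ⟨m, hm⟩ := hb e n he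
    obtain ⟨m', hm'⟩ := ha _ m hm
    exact ⟨m', by rwa [mul_assoc]⟩

/-- Up to shorter words, the variables of the polynomial ring act as the elements `x i`. -/
theorem ofSymbol_X_mul_sub_mem (hx : AlmostCommutes R x) (i : ι) {n : ℕ}
    {p : MvPolynomial ι R} (hp : p.IsHomogeneous n) :
    ofSymbol R x (MvPolynomial.X i * p) - x i * ofSymbol R x p ∈ wordSpan R x (n + 1) := by
  rw [p.as_sum, Finset.mul_sum, map_sum, map_sum, Finset.mul_sum, ← Finset.sum_sub_distrib]
  refine sum_mem fun α hα => ?_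
  have hlen : α.toMultiset.toList.length = n := by
    have := hp (MvPolynomial.mem_support_iff.mp hα)
    rw [Multiset.length_toList, Finsupp.card_toMultiset, ← this]
    exact congrFun (congrArg DFunLike.coe (Finsupp.degree_eq_weight_one (R := ℕ))) α
  obtain ⟨s, hs⟩ := hx.mul_smul i (p.coeff α)
  rw [MvPolynomial.X, MvPolynomial.monomial_mul, one_mul, ofSymbol_monomial, ofSymbol_monomial, hs,
    ← sub_sub, ← smul_sub]
  refine sub_mem (Submodule.smul_mem _ _ ?_) (Submodule.smul_mem _ _ (prod_mem_wordSpan ?_))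
  · have hperm : (Finsupp.single i 1 + α).toMultiset.toList.Perm (i :: α.toMultiset.toList) := by
      rw [← Multiset.coe_eq_coe, Multiset.coe_toList, ← Multiset.cons_coe, Multiset.coe_toList,
        Finsupp.toMultiset_add, Finsupp.toMultiset_single, one_smul, Multiset.singleton_add]
    have := hx.prod_sub_prod_mem hperm
    rwa [hperm.length_eq, List.length_cons, hlen, List.map_cons, List.prod_cons] at this
  · omega

/-- Every element has a leading symbol. -/
theorem exists_isHomogeneous_sub_mem (hx : AlmostCommutes R x) {n : ℕ} {d : D}
    (hd : d ∈ wordSpan R x (n + 1)) :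
    ∃ p : MvPolynomial ι R, p.IsHomogeneous n ∧ d - ofSymbol R x p ∈ wordSpan R x n := by
  classical
  induction hd using Submodule.span_induction with
  | mem d hd =>
    obtain ⟨l, hl, rfl⟩ := hd
    rcases (Nat.lt_succ_iff.mp hl).lt_or_eq with h | h
    · exact ⟨0, MvPolynomial.isHomogeneous_zero _ _ _, by simpa using prod_mem_wordSpan h⟩
    · refine ⟨MvPolynomial.monomial (Multiset.toFinsupp (l : Multiset ι)) 1,
        MvPolynomial.isHomogeneous_monomial _ ?_, ?_⟩
      · rw [← h, ← Multiset.coe_card, ← Multiset.toFinsupp_toMultiset (l : Multiset ι),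
          Finsupp.card_toMultiset, Multiset.toFinsupp_toMultiset]
        rfl
      · rw [ofSymbol_monomial, one_smul, Multiset.toFinsupp_toMultiset]
        have := hx.prod_sub_prod_mem (l := l) (l' := (l : Multiset ι).toList)
          (Multiset.coe_eq_coe.mp (Multiset.coe_toList _).symm)
        rwa [h] at this
  | zero => exact ⟨0, MvPolynomial.isHomogeneous_zero _ _ _, by simp⟩
  | add d e _ _ hd he =>
    obtain ⟨p, hp, hd⟩ := hd
    obtain ⟨q, hq, he⟩ := he
    refine ⟨p + q, hp.add hq, ?_⟩
    rw [map_add, add_sub_add_comm]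
    exact add_mem hd he
  | smul r d _ hd =>
    obtain ⟨p, hp, hd⟩ := hd
    refine ⟨r • p, ?_, ?_⟩
    · exact (MvPolynomial.homogeneousSubmodule ι R n).smul_mem r hp
    · rw [map_smul, ← smul_sub]
      exact Submodule.smul_mem _ _ hd

theorem homogeneousComponent_X_mul (i : ι) (p : MvPolynomial ι R) (n : ℕ) :
    MvPolynomial.homogeneousComponent (n + 1) (MvPolynomial.X i * p) =
      MvPolynomial.X i * MvPolynomial.homogeneousComponent n p := by
  classical
  ext α
  rw [MvPolynomial.coeff_homogeneousComponent, MvPolynomial.coeff_X_mul',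
    MvPolynomial.coeff_X_mul', MvPolynomial.coeff_homogeneousComponent]
  by_cases hi : i ∈ α.support
  · obtain ⟨β, rfl⟩ : ∃ β, α = β + Finsupp.single i 1 :=
      ⟨α - Finsupp.single i 1, (tsub_add_cancel_of_le (Finsupp.single_le_iff.mpr
        (Nat.one_le_iff_ne_zero.mpr (Finsupp.mem_support_iff.mp hi)))).symm⟩
    simp [hi, map_add]
  · simp [hi]

variable (x) in
/-- The leading symbols of elements of a left ideal. -/
def symbolIdeal (hx : AlmostCommutes R x) (L : Submodule D D) : Ideal (MvPolynomial ι R) where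
  carrier := {p | ∀ n, ∃ b ∈ L,
    ofSymbol R x (MvPolynomial.homogeneousComponent n p) - b ∈ wordSpan R x n}
  zero_mem' n := ⟨0, zero_mem L, by simp⟩
  add_mem' {p q} hp hq n := by
    obtain ⟨b, hb, hpb⟩ := hp n
    obtain ⟨c, hc, hqc⟩ := hq n
    refine ⟨b + c, add_mem hb hc, ?_⟩
    rw [map_add, map_add, add_sub_add_comm]
    exact add_mem hpb hqc
  smul_mem' q p hp := by
    induction q using MvPolynomial.induction_on generalizing p with
    | C r =>
      intro n
      obtain ⟨b, hb, hpb⟩ := hp n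
      refine ⟨(r • (1 : D)) * b, L.smul_mem _ hb, ?_⟩
      rw [smul_eq_mul, MvPolynomial.homogeneousComponent_C_mul, MvPolynomial.C_mul', map_smul,
        smul_mul_assoc, one_mul, ← smul_sub]
      exact Submodule.smul_mem _ _ hpb
    | add q q' hq hq' =>
      intro n
      obtain ⟨b, hb, hpb⟩ := hq p hp n
      obtain ⟨c, hc, hqc⟩ := hq' p hp n
      refine ⟨b + c, add_mem hb hc, ?_⟩
      rw [add_smul, map_add, map_add, add_sub_add_comm]
      exact add_mem hpb hqc
    | mul_X q i hq =>
      rw [smul_eq_mul, mul_assoc]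
      refine hq _ fun n => ?_
      cases n with
      | zero =>
        refine ⟨0, zero_mem L, ?_⟩
        have : MvPolynomial.homogeneousComponent 0 (MvPolynomial.X i * p) = 0 := by
          classical
          rw [MvPolynomial.homogeneousComponent_zero, MvPolynomial.coeff_X_mul']
          simp
        rw [this, map_zero, sub_zero]
        exact zero_mem _
      | succ n =>
        obtain ⟨b, hb, hpb⟩ := hp n
        refine ⟨x i * b, L.smul_mem _ hb, ?_⟩
        rw [homogeneousComponent_X_mul, ← sub_add_sub_cancel _
          (x i * ofSymbol R x (MvPolynomial.homogeneousComponent n p)), ← mul_sub]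
        exact add_mem (hx.ofSymbol_X_mul_sub_mem i
          (MvPolynomial.homogeneousComponent_isHomogeneous n p)) (hx.mul_mem_wordSpan i hpb)

theorem symbolIdeal_mono (hx : AlmostCommutes R x) {L L' : Submodule D D} (h : L ≤ L') :
    symbolIdeal x hx L ≤ symbolIdeal x hx L' := fun _ hp n =>
  let ⟨b, hb, hpb⟩ := hp n
  ⟨b, h hb, hpb⟩

/-- A left ideal is determined, among the ones containing it, by its leading symbols. -/
theorem eq_of_symbolIdeal_le (hx : AlmostCommutes R x)
    (hgen : Subring.closure (Set.range (fun r : R => r • (1 : D)) ∪ Set.range x) = ⊤)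
    {L L' : Submodule D D} (h : L ≤ L') (hle : symbolIdeal x hx L' ≤ symbolIdeal x hx L) :
    L = L' := by
  refine le_antisymm h fun a ha => ?_
  obtain ⟨n, hn⟩ := hx.exists_mem_wordSpan hgen a
  induction n generalizing a with
  | zero =>
    have : wordSpan R x 0 = ⊥ := by simp [wordSpan]
    rw [this, Submodule.mem_bot] at hn
    exact hn ▸ zero_mem L
  | succ n ih =>
    obtain ⟨p, hp, hap⟩ := hx.exists_isHomogeneous_sub_mem hn
    have hpL : p ∈ symbolIdeal x hx L := by
      refine hle fun m => ?_
      by_cases hm : m = n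
      · subst hm
        refine ⟨a, ha, ?_⟩
        rw [MvPolynomial.homogeneousComponent_eq_self hp, ← neg_sub]
        exact neg_mem hap
      · refine ⟨0, zero_mem L', ?_⟩
        rw [MvPolynomial.homogeneousComponent_of_mem hp, if_neg (by tauto), map_zero, sub_zero]
        exact zero_mem _
    obtain ⟨b, hb, hpb⟩ := hpL n
    rw [MvPolynomial.homogeneousComponent_eq_self hp] at hpb
    have hab : a - b ∈ L := by
      refine ih (a - b) (sub_mem ha (h hb)) ?_
      rw [← sub_add_sub_cancel a (ofSymbol R x p)]
      exact add_mem hap hpb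
    simpa using add_mem hab hb

/-- A ring generated over a Noetherian ring by finitely many almost commuting elements is left
Noetherian: taking leading symbols embeds its left ideals, preserving strict inclusions, in the
ideals of a polynomial ring. -/
theorem isNoetherianRing [IsNoetherianRing R] [Finite ι] (hx : AlmostCommutes R x)
    (hgen : Subring.closure (Set.range (fun r : R => r • (1 : D)) ∪ Set.range x) = ⊤) :
    IsNoetherianRing D := by
  have hmono : StrictMono (symbolIdeal x hx) := fun L L' h =>
    lt_of_le_of_ne (symbolIdeal_mono hx h.le) fun heq =>
      h.ne (hx.eq_of_symbolIdeal_le hgen h.le heq.ge)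
  have := hmono.wellFoundedGT
  exact isNoetherian_iff'.mpr this

end AlmostCommutes

end AlmostCommutative

/-! ### Rings of differential operators -/

section DiffOps

variable {K R : Type*} [CommRing K] [CommRing R] [Algebra K R]

/-- Multiplication operators as a ring homomorphism to the ring of differential operators. -/
def mulHom (K R : Type*) [CommRing K] [CommRing R] [Algebra K R] : R →+* diffOps K R :=
  ((Algebra.lmul K R : R →ₐ[K] Module.End K R) : R →+* Module.End K R).codRestrict (diffOps K R)
    mulLeft_mem_diffOps

instance : Module R (diffOps K R) := Module.compHom _ (mulHom K R)

instance : IsScalarTower R (diffOps K R) (diffOps K R) :=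
  ⟨fun r a b => mul_assoc (mulHom K R r) a b⟩

/-- Derivations as differential operators. -/
def derivationHom (K R : Type*) [CommRing K] [CommRing R] [Algebra K R] :
    Derivation K R R →ₗ[R] diffOps K R where
  toFun d := ⟨d, derivation_mem_diffOps d⟩
  map_add' _ _ := rfl
  map_smul' _ _ := rfl

/-- The ring of differential operators is left Noetherian if the module of derivations is finitely
generated. -/
theorem isNoetherianRing_diffOps [IsNoetherianRing R] [Module.Finite R (Derivation K R R)] :
    IsNoetherianRing (diffOps K R) := by
  obtain ⟨n, d, hd⟩ := Module.Finite.exists_fin (R := R) (M := Derivation K R R)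
  let x (i : Fin n) : diffOps K R := derivationHom K R (d i)
  have hspan (e : Derivation K R R) : derivationHom K R e ∈ Submodule.span R (Set.range x) := by
    have : Set.range x = derivationHom K R '' Set.range d := by
      rw [← Set.range_comp]
      rfl
    rw [this, ← Submodule.map_span, hd]
    exact ⟨e, trivial, rfl⟩
  have hx : AlmostCommutes R x :=
    { mul_smul_one i r := by
        refine ⟨d i r, Subtype.ext (LinearMap.ext fun a => ?_)⟩
        change d i (r * a) = r * d i a + d i r * a
        rw [Derivation.leibniz, smul_eq_mul, smul_eq_mul, mul_comm a]
      commutator_mem i j := by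
        have : x i * x j - x j * x i = derivationHom K R ⁅d i, d j⁆ :=
          Subtype.ext (LinearMap.ext fun a => (Derivation.commutator_apply _).symm)
        rw [this]
        exact hspan _ }
  refine hx.isNoetherianRing (eq_top_iff.mpr ?_)
  set S := Subring.closure (Set.range (fun r : R => r • (1 : diffOps K R)) ∪ Set.range x)
  have hspanS (y : diffOps K R) (hy : y ∈ Submodule.span R (Set.range x)) : y ∈ S := by
    induction hy using Submodule.span_induction with
    | mem y hy => exact Subring.subset_closure (Or.inr hy)
    | zero => exact zero_mem S
    | add y z _ _ hy hz => exact add_mem hy hz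
    | smul r y _ hy =>
      rw [← one_mul y, ← smul_mul_assoc]
      exact mul_mem (Subring.subset_closure (Or.inl ⟨r, rfl⟩)) hy
  have hle : diffOps K R ≤ S.map (diffOps K R).subtype := by
    refine Subring.closure_le.mpr ?_
    rintro _ (⟨e, rfl⟩ | ⟨r, rfl⟩)
    · exact ⟨derivationHom K R e, hspanS _ (hspan e), rfl⟩
    · exact ⟨mulHom K R r, Subring.subset_closure (Or.inl ⟨r, mul_one (mulHom K R r)⟩), rfl⟩
  intro P _
  obtain ⟨Q, hQ, hQP⟩ := hle P.2
  rwa [← Subtype.ext hQP]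

end DiffOps

section OperatorModules

variable {K R : Type u} [CommRing K] [CommRing R] [Algebra K R]

variable (K R) in
/-- The family of all `K`-linear derivations of `R`. -/
def allDerivations (d : Derivation K R R) : Derivation ℤ R R := d.restrictScalars ℤ

instance : Module (OperatorRing (allDerivations K R)) R :=
  moduleOfOperators (fun d : Derivation K R R => ((d : R →ₗ[K] R) : R →+ R)) fun d r s => by
    change d (r * s) = d r * s + r * d s
    rw [Derivation.leibniz, smul_eq_mul, smul_eq_mul, mul_comm s, add_comm]

instance : IsScalarTower R (OperatorRing (allDerivations K R)) R :=
  isScalarTower_moduleOfOperators _ _ _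

theorem symbol_smul_self (d : Derivation K R R) (r : R) :
    symbol (allDerivations K R) d • r = d r :=
  toEnd_symbol _ _ _ d r

/-- The action of a derivation on `R_h`. -/
def awayOperator (h : R) (d : Derivation K R R) : Localization.Away h →+ Localization.Away h :=
  DistribSMul.toAddMonoidHom _ (derivationHom K R d)

theorem awayOperator_smul (h : R) (d : Derivation K R R) (r : R) (y : Localization.Away h) :
    awayOperator h d (r • y) = allDerivations K R d r • y + r • awayOperator h d y := by
  rw [Algebra.smul_def, Algebra.smul_def, Algebra.smul_def]
  refine (derivation_smul_mul h d _ y).trans ?_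
  rw [add_comm, mul_comm y]
  exact congrArg (· * y + _) (smul_algebraMap h _ r)

/-- On `R_h`, which is also the localization of the module `R` over the operator ring, the symbol of
a derivation acts as the corresponding differential operator. -/
theorem symbol_smul_away (h : R) (d : Derivation K R R) (y : Localization.Away h) :
    symbol (allDerivations K R) d • y = derivationHom K R d • y := by
  obtain ⟨s, hs, r, hr⟩ := exists_smul_eq_toLocalized (δ := allDerivations K R) y
  have hr' : s • y = algebraMap R (Localization.Away h) r := hr
  have h1 : symbol (allDerivations K R) d • s • y = awayOperator h d (s • y) := by
    refine Eq.trans ?_ ((congrArg (awayOperator h d) hr').trans (smul_algebraMap h _ r)).symm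
    rw [hr, ← map_smul, symbol_smul_self]
    rfl
  rw [symbol_smul_smul, awayOperator_smul] at h1
  rw [← sub_eq_zero]
  refine smul_localized_eq_zero (M := R) hs ?_
  rw [smul_sub, sub_eq_zero]
  exact add_left_cancel h1

/-- Submodules of `R_h` over the operator ring are submodules over the ring of differential
operators. -/
theorem isNoetherian_away (h : R) [IsNoetherian (diffOps K R) (Localization.Away h)] :
    IsNoetherian (OperatorRing (allDerivations K R)) (Localization.Away h) := by
  -- a submodule over the operator ring is stable under all differential operators
  have hstable (N : Submodule (OperatorRing (allDerivations K R)) (Localization.Away h))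
      (P : Module.End K R) (hP : P ∈ diffOps K R) :
      ∀ y ∈ N, (⟨P, hP⟩ : diffOps K R) • y ∈ N := by
    induction hP using Subring.closure_induction with
    | mem P hP =>
      intro y hy
      obtain ⟨d, rfl⟩ | ⟨r, rfl⟩ := hP
      · exact (symbol_smul_away h d y).subst (motive := (· ∈ N)) (N.smul_mem _ hy)
      · exact (mulLeft_smul (K := K) h r y).symm.subst (motive := (· ∈ N))
          (N.smul_of_tower_mem r hy)
    | zero =>
      intro y _
      exact (zero_smul (diffOps K R) y).symm.subst (motive := (· ∈ N)) N.zero_mem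
    | one =>
      intro y hy
      exact (one_smul (diffOps K R) y).symm.subst (motive := (· ∈ N)) hy
    | add P Q hP hQ hP' hQ' =>
      intro y hy
      exact (add_smul (⟨P, hP⟩ : diffOps K R) ⟨Q, hQ⟩ y).symm.subst (motive := (· ∈ N))
        (N.add_mem (hP' y hy) (hQ' y hy))
    | neg P hP hP' =>
      intro y hy
      exact (neg_smul (⟨P, hP⟩ : diffOps K R) y).symm.subst (motive := (· ∈ N))
        (N.neg_mem (hP' y hy))
    | mul P Q hP hQ hP' hQ' =>
      intro y hy
      exact (mul_smul (⟨P, hP⟩ : diffOps K R) ⟨Q, hQ⟩ y).symm.subst (motive := (· ∈ N))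
        (hP' _ (hQ' y hy))
  let toDiffOps (N : Submodule (OperatorRing (allDerivations K R)) (Localization.Away h)) :
      Submodule (diffOps K R) (Localization.Away h) :=
    { carrier := N
      add_mem' := N.add_mem
      zero_mem' := N.zero_mem
      smul_mem' P y hy := hstable N P.1 P.2 y hy }
  have hmono : StrictMono toDiffOps := fun N N' hN => hN
  exact isNoetherian_iff'.mpr hmono.wellFoundedGT

end OperatorModules

section Finiteness

variable {R ι : Type u} [CommRing R] [IsNoetherianRing R] {δ : ι → Derivation ℤ R R}

/-- If all localizations of `M` at one element are Noetherian over the operator ring, then so are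
the local cohomology modules of `M`, which therefore have finitely many associated primes. -/
theorem finite_associatedPrimes_localCohomology (M : Type u) [AddCommGroup M] [Module R M]
    [Module (OperatorRing δ) M] [IsScalarTower R (OperatorRing δ) M] (hM : AwayNoetherian δ M)
    (I : Ideal R) (i : ℕ) :
    (associatedPrimes R ((localCohomology I i).obj (ModuleCat.of R M))).Finite := by
  obtain ⟨F, hF₀, hF⟩ := Stage.exists_resolution δ M
  have h₁ : AwayNoetherian δ (F 0).M := by
    rw [hF₀]
    exact hM
  have h₂ : (F 0).π = 0 := by
    rw [hF₀]
    rfl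
  obtain ⟨e⟩ := Stage.nonempty_torsionQuotient_linearEquiv F hF h₂ I i
  have := (Stage.awayNoetherian_torsionQuotient F hF h₁ I i).isNoetherian
  have h₃ := finite_associatedPrimes (R := R) (δ := δ) (M := TorsionQuotient I (F i).π)
  rw [LinearEquiv.AssociatedPrimes.eq e, hF₀] at h₃
  exact h₃

end Finiteness

end DiffOp

end

theorem theorem5p2 {A : Type u} [CommRing A] [IsDomain A] [IsNoetherianRing A] [IsLocalRing A]
    [IsAdicComplete (maximalIdeal A) A] [CharZero (ResidueField A)]
    (hdim : 2 ≤ ringKrullDim A) (hsing : ¬ IsRegularLocalRing A)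
    (σ : ResidueField A →+* A) (hσ : ∀ x, residue A (σ x) = x)
    (J : Ideal A) (hJ : PrimeSpectrum.zeroLocus (J : Set A) = DiffOp.singularLocus A)
    (f : A) (hfJ : f ∈ J) (hf0 : f ≠ 0)
    (hfin : ∀ h : Localization.Away f, h ≠ 0 →
      Module.Finite
        (DiffOp.diffOps
          (DiffOp.laurentSubfield (maximalIdeal A) σ f
            (DiffOp.mem_maximalIdeal_of_mem hsing hJ hfJ))
          (Localization.Away f))
        (Localization.Away h))
    (I : Ideal (Localization.Away f)) (i : ℕ) :
    (associatedPrimes (Localization.Away f)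
      ((localCohomology I i).obj
        (ModuleCat.of (Localization.Away f) (Localization.Away f)))).Finite := by
  have hf := DiffOp.mem_maximalIdeal_of_mem hsing hJ hfJ
  have : IsNoetherianRing (Localization.Away f) :=
    IsLocalization.isNoetherianRing (Submonoid.powers f) _ inferInstance
  have : Module.Finite (Localization.Away f)
      (Derivation (DiffOp.laurentSubfield (maximalIdeal A) σ f hf) (Localization.Away f)
        (Localization.Away f)) :=
    DiffOp.finite_derivation_laurentSubfield σ hf rfl
      (fun a => ⟨residue A a, (residue_eq_zero_iff _).mp (by rw [map_sub, hσ, sub_self])⟩) hf0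
  have : IsNoetherianRing (DiffOp.diffOps (DiffOp.laurentSubfield (maximalIdeal A) σ f hf)
      (Localization.Away f)) := DiffOp.isNoetherianRing_diffOps
  refine DiffOp.finite_associatedPrimes_localCohomology
    (δ := DiffOp.allDerivations (DiffOp.laurentSubfield (maximalIdeal A) σ f hf)
      (Localization.Away f)) (Localization.Away f) (fun h => ?_) I i
  by_cases h0 : h = 0
  · subst h0
    have : Subsingleton (LocalizedModule (Submonoid.powers (0 : Localization.Away f))
        (Localization.Away f)) := by
      refine (subsingleton_iff_forall_eq 0).mpr fun y => ?_
      exact DiffOp.OperatorRing.smul_localized_eq_zero (Submonoid.mem_powers 0) (zero_smul _ y)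
    infer_instance
  · have := hfin h h0
    exact DiffOp.isNoetherian_away h
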